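/- Let $n,r\ge 0$ be integers. Let $\mathbf S_0(n,r)$ be the $0$-Schur algebra over $\mathbb C$, with its standard basis $e_A$ indexed by the set $M_n(r)$ of $n\times n$ matrices $A=(a_{i,j})$ of nonnegative integers with total sum $r$. Write $\mathrm{ro}(A)$ and $\mathrm{co}(A)$ for the row-sum and column-sum vectors of $A$. The product is $e_Ae_B=0$ if $\mathrm{co}(A)\ne \mathrm{ro}(B)$, and otherwise $e_Ae_B=e_C$, where $C\in M_n(r)$ is the matrix whose corner sums $R_C(i,j)=\sum_{k\le i,\,l\le j}c_{k,l}$ are $$R_C(i,j)=\max_{0\le k\le n}\bigl(R_A(i,k)+R_B(k,j)-R_B(k,n)\bigr)$$ (equivalently, $C$ is the open orbit in the composite of the orbits $A$ and $B$ of pairs of $n$-step flags in $\mathbb C^r$). For a weak composition $\lambda=(\lambda_1,\dots,\lambda_n)$ of $r$ put $D_\lambda=\mathrm{diag}(\lambda_1,\dots,\lambda_n)$ and $k_\lambda=e_{D_\lambda}$; the unit is $\sum_\lambda k_\lambda$. For $1\le i\le n-1$ let $$e_i=\sum_{\lambda:\lambda_{i+1}>0}e_{D_\lambda-E_{i+1,i+1}+E_{i,i+1}},\qquad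 f_i=\sum_{\lambda:\lambda_i>0}e_{D_\lambda-E_{i,i}+E_{i+1,i}},$$ where the $E_{a,b}$ are the matrix units. Let $\lambda$ be a weak composition of $r$ of length $n$ such that $\lambda_i=0$ implies $\lambda_j=0$ for all $j>i$. A strong composition $\alpha$ of $n$ (one with positive parts) cuts $\{1,\dots,n\}$ into consecutive intervals; it is called maximal with respect to $\lambda$ if, for each of these intervals, the corresponding subsequence of $\lambda$ is either $(0)$ or has neither its first nor its last entry equal to $0$. A matrix $A\in M_n(r)$ is open on columns with respect to $\alpha$ if there are no $i<i'$ and $j<j'$, with $j,j'$ in the same interval of $\alpha$, such that $a_{i,j}>0$ and $a_{i',j'}>0$. Let $B^\lambda$ be the set of all $e_A$ with $\mathrm{co}(A)=\lambda$ such that $A$ is not open on columns with respect to any $\alpha\neq(1,\dots,1)$ that is maximal with respect to $\lambda$. Let $P_\lambda$ be the $\mathbf S_0(n,r)$-module with $\mathbb C$-basis $B^\lambda$ on which algebra elements act by multiplication in $\mathbf S_0(n,r)$ followed by deleting all basis elements outside $B^\lambda$. A matrix $A$ of nonnegative integers is column block diagonal if $a_{i,j}>0$ implies $a_{s,t}=0$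 for all $s\le i$ and $t>j$. Let $\mathrm{CB}(\lambda)$ be the set of column block diagonal $A\in M_n(r)$ with $\mathrm{co}(A)=\lambda$, and let $\beta^\lambda=\{e_A: A\in \mathrm{CB}(\lambda)\}\subseteq B^\lambda$. Let $N_\lambda\subseteq P_\lambda$ be the submodule spanned over $\mathbb C$ by $B^\lambda\setminus\beta^\lambda$, let $S_\lambda=P_\lambda/N_\lambda$, and write $\overline{e_A}$ and $\overline{k_\lambda}$ for the classes of $e_A$ and $k_\lambda$ in $S_\lambda$. Let $A\in \mathrm{CB}(\lambda)$. Then: (1) There are $l\ge 0$ and indices $1\le i_1,\dots,i_l\le n-1$ such that $e_{i_1}e_{i_2}\cdots e_{i_l}\cdot\overline{e_A}=\overline{k_\lambda}$. (2) For all $l\ge 0$ and all indices $1\le i_1,\dots,i_l\le n-1$, $$e_{i_1}e_{i_2}\cdots e_{i_l}\cdot\overline{e_A}=\overline{k_\lambda}\iff \overline{e_A}=f_{i_l}\cdots f_{i_2}f_{i_1}\cdot\overline{k_\lambda}.$$ (3) If $\overline{e_A}=f_{i_l}\cdots f_{i_2}f_{i_1}\cdot\overline{k_\lambda}=f_{j_s}\cdots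 f_{j_2}f_{j_1}\cdot\overline{k_\lambda}$, then the multisets $\{i_1,\dots,i_l\}$ and $\{j_1,\dots,j_s\}$ are equal. In particular, $l=s$. -/

import Mathlib

namespace ZeroSchur

open Finset

/-! ### Weak compositions, matrices, corner sums -/

/-- `Λ(n,r)`: weak compositions of `r` of length `n`. -/
def WComp (n r : ℕ) : Type := {l : Fin n → ℕ // ∑ i, l i = r}

instance (n r : ℕ) : DecidableEq (WComp n r) :=
  inferInstanceAs (DecidableEq {l : Fin n → ℕ // ∑ i, l i = r})

instance (n r : ℕ) : Fintype (WComp n r) :=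
  Fintype.subtype (Finset.piAntidiag Finset.univ r) (by simp)

/-- Membership in `Λ•(n,r)`: a zero part is followed by zero parts only. -/
def IsBullet {n r : ℕ} (l : WComp n r) : Prop :=
  ∀ i j : Fin n, i < j → l.1 i = 0 → l.1 j = 0

/-- `M_n(r)`: the `n × n` matrices of nonnegative integers with total sum `r`. -/
def Mat (n r : ℕ) : Type := {A : Matrix (Fin n) (Fin n) ℕ // ∑ i, ∑ j, A i j = r}

/-- The row-sum vector. -/
def ro {n : ℕ} (A : Matrix (Fin n) (Fin n) ℕ) : Fin n → ℕ := fun i => ∑ j, A i j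

/-- The column-sum vector. -/
def co {n : ℕ} (A : Matrix (Fin n) (Fin n) ℕ) : Fin n → ℕ := fun j => ∑ i, A i j

/-- The entries of `A`, extended by zero to all pairs of natural numbers. -/
def entry {n : ℕ} (A : Matrix (Fin n) (Fin n) ℕ) (k l : ℕ) : ℤ :=
  if h : k < n ∧ l < n then (A ⟨k, h.1⟩ ⟨l, h.2⟩ : ℤ) else 0

/-- The sum of the entries of `A` in the first `i` rows and first `j` columns. If `A` is the
relative position of a pair of flags `(V, V')`, this is `dim (V_i ∩ V'_j)`. -/
def corner {n : ℕ} (A : Matrix (Fin n) (Fin n) ℕ) (i j : ℕ) : ℤ :=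
  ∑ k ∈ range i, ∑ l ∈ range j, entry A k l

section corner

variable {n : ℕ} (A B C : Matrix (Fin n) (Fin n) ℕ)

lemma entry_nonneg (k l : ℕ) : 0 ≤ entry A k l := by
  unfold entry; split_ifs <;> simp

lemma entry_fin (i j : Fin n) : entry A i j = A i j := by simp [entry]

lemma entry_eq (i j : ℕ) : entry A i j =
    corner A (i + 1) (j + 1) + corner A i j - corner A (i + 1) j - corner A i (j + 1) := by
  simp only [corner, sum_range_succ, sum_add_distrib]; ring

lemma corner_zero_left (j : ℕ) : corner A 0 j = 0 := by simp [corner]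

lemma corner_zero_right (i : ℕ) : corner A i 0 = 0 := by simp [corner]

lemma corner_super {i i' j j' : ℕ} (hi : i ≤ i') (hj : j ≤ j') :
    corner A i' j + corner A i j' ≤ corner A i' j' + corner A i j := by
  have hm : Monotone (fun i => corner A i j' - corner A i j) := by
    refine monotone_nat_of_le_succ fun k => ?_
    have : ∑ l ∈ range j, entry A k l ≤ ∑ l ∈ range j', entry A k l :=
      sum_le_sum_of_subset_of_nonneg (range_mono hj) fun l _ _ => entry_nonneg A k l
    simp only [corner, sum_range_succ]
    linarith
  have := hm hi
  simp only at this
  linarith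

lemma corner_mono_left {i i' : ℕ} (hi : i ≤ i') (j : ℕ) : corner A i j ≤ corner A i' j := by
  have := corner_super A hi (Nat.zero_le j)
  simp only [corner_zero_right] at this
  linarith

lemma corner_mono_right (i : ℕ) {j j' : ℕ} (hj : j ≤ j') : corner A i j ≤ corner A i j' := by
  have := corner_super A (Nat.zero_le i) hj
  simp only [corner_zero_left] at this
  linarith

lemma corner_sat_left {i : ℕ} (hi : n ≤ i) (j : ℕ) : corner A i j = corner A n j := by
  unfold corner
  symm
  refine sum_subset (range_mono hi) fun k _ hk => sum_eq_zero fun l _ => ?_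
  have : ¬ k < n := by simpa using hk
  simp [entry, this]

lemma corner_sat_right (i : ℕ) {j : ℕ} (hj : n ≤ j) : corner A i j = corner A i n := by
  unfold corner
  refine sum_congr rfl fun k _ => ?_
  symm
  refine sum_subset (range_mono hj) fun l _ hl => ?_
  have : ¬ l < n := by simpa using hl
  simp [entry, this]

lemma corner_le_n_left (i j : ℕ) : corner A i j ≤ corner A n j := by
  rcases le_total i n with h | h
  · exact corner_mono_left A h j
  · exact (corner_sat_left A h j).le

lemma corner_le_n_right (i j : ℕ) : corner A i j ≤ corner A i n := by
  rcases le_total j n with h | h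
  · exact corner_mono_right A i h
  · exact (corner_sat_right A i h).le

lemma corner_inj (h : ∀ i j, corner A i j = corner B i j) : A = B := by
  ext i j
  have : entry A i j = entry B i j := by simp only [entry_eq, h]
  simpa [entry_fin] using this

lemma sum_row (k : Fin n) : ∑ l ∈ range n, entry A k l = (ro A k : ℤ) := by
  rw [Finset.sum_range]; simp [entry, ro]

lemma sum_col (l : Fin n) : ∑ k ∈ range n, entry A k l = (co A l : ℤ) := by
  rw [Finset.sum_range]; simp [entry, co]

lemma rect_eq {i i' j j' : ℕ} (hi : i ≤ i') (hj : j ≤ j') :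
    corner A i' j' + corner A i j - corner A i' j - corner A i j' =
      ∑ k ∈ Ico i i', ∑ l ∈ Ico j j', entry A k l := by
  simp only [sum_Ico_eq_sub _ hj, sum_Ico_eq_sub _ hi, sum_sub_distrib, corner]
  ring

/-- The block sum of rows `i, …, i'-1` and columns `j, …, j'-1` vanishes iff all entries do. -/
lemma rect_eq_zero_iff {i i' j j' : ℕ} (hi : i ≤ i')
    (hj : j ≤ j') : corner A i' j' + corner A i j - corner A i' j - corner A i j' = 0 ↔
      ∀ s t : Fin n, i ≤ s → (s : ℕ) < i' → j ≤ t → (t : ℕ) < j' → A s t = 0 := by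
  rw [rect_eq A hi hj, sum_eq_zero_iff_of_nonneg
    (fun k _ => sum_nonneg fun l _ => entry_nonneg A k l)]
  constructor
  · intro h s t h1 h2 h3 h4
    have := (sum_eq_zero_iff_of_nonneg (fun l _ => entry_nonneg A s l)).1
      (h s (mem_Ico.2 ⟨h1, h2⟩)) t (mem_Ico.2 ⟨h3, h4⟩)
    rw [entry_fin] at this
    exact_mod_cast this
  · intro h s hs
    refine sum_eq_zero fun t ht => ?_
    rw [mem_Ico] at hs ht
    unfold entry
    split_ifs with hh
    · exact_mod_cast h ⟨s, hh.1⟩ ⟨t, hh.2⟩ hs.1 hs.2 ht.1 ht.2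
    · rfl

lemma corner_row (i : ℕ) (hi : i ≤ n) :
    corner A i n = ∑ k ∈ range i, (if h : k < n then (ro A ⟨k, h⟩ : ℤ) else 0) := by
  unfold corner
  refine sum_congr rfl fun k hk => ?_
  have h : k < n := lt_of_lt_of_le (by simpa using hk) hi
  rw [dif_pos h, ← sum_row]

lemma corner_col (j : ℕ) (hj : j ≤ n) :
    corner A n j = ∑ l ∈ range j, (if h : l < n then (co A ⟨l, h⟩ : ℤ) else 0) := by
  unfold corner
  rw [sum_comm]
  refine sum_congr rfl fun k hk => ?_
  have h : k < n := lt_of_lt_of_le (by simpa using hk) hj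
  rw [dif_pos h, ← sum_col]

variable {A B} in
lemma corner_compat (h : co A = ro B) (k : ℕ) : corner A n k = corner B k n := by
  rcases le_total k n with hk | hk
  · rw [corner_col A k hk, corner_row B k hk, h]
  · rw [corner_sat_right A n hk, corner_sat_left B hk, corner_col A n le_rfl,
      corner_row B n le_rfl, h]

lemma ro_eq_of_corner (h : ∀ i, corner A i n = corner B i n) : ro A = ro B := by
  ext i
  have hA := corner_row A (i + 1) i.2
  have hA' := corner_row A i i.2.le
  have hB := corner_row B (i + 1) i.2
  have hB' := corner_row B i i.2.le
  rw [sum_range_succ, ← hA', dif_pos i.2] at hA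
  rw [sum_range_succ, ← hB', dif_pos i.2] at hB
  have h1 := h (i + 1)
  have h2 := h i
  have : (ro A i : ℤ) = ro B i := by simp only [Fin.eta] at hA hB; linarith
  exact_mod_cast this

lemma co_eq_of_corner (h : ∀ j, corner A n j = corner B n j) : co A = co B := by
  ext i
  have hA := corner_col A (i + 1) i.2
  have hA' := corner_col A i i.2.le
  have hB := corner_col B (i + 1) i.2
  have hB' := corner_col B i i.2.le
  rw [sum_range_succ, ← hA', dif_pos i.2] at hA
  rw [sum_range_succ, ← hB', dif_pos i.2] at hB
  have h1 := h (i + 1)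
  have h2 := h i
  have : (co A i : ℤ) = co B i := by simp only [Fin.eta] at hA hB; linarith
  exact_mod_cast this

end corner

/-! ### The multiplication rule of the standard basis -/

/-- For flags `V, V', V''` with `(V, V')` in relative position `A` and `(V', V'')` in relative
position `B`, one has `dim (V_i ∩ V''_j) ≥ dim (V_i ∩ V'_k) + dim (V'_k ∩ V''_j) - dim V'_k` for
all `k`. The maximum over `k` of the right-hand side is the value of `dim (V_i ∩ V''_j)` for
generic such flags, that is, in the open orbit. -/
def prodCorner {n : ℕ} (A B : Matrix (Fin n) (Fin n) ℕ) (i j : ℕ) : ℤ :=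
  (range (n + 1)).sup' nonempty_range_add_one
    (fun k => corner A i k + corner B k j - corner B k n)

/-- The matrix `C` with `e_A e_B = e_C` (when `co A = ro B`): the matrix with corner sums
`prodCorner A B`; see `corner_mulMat`. -/
def mulMat {n : ℕ} (A B : Matrix (Fin n) (Fin n) ℕ) : Matrix (Fin n) (Fin n) ℕ := fun i j =>
  (prodCorner A B (i + 1) (j + 1) + prodCorner A B i j
    - prodCorner A B (i + 1) j - prodCorner A B i (j + 1)).toNat

section mul

variable {n : ℕ} {A B C : Matrix (Fin n) (Fin n) ℕ}

lemma le_prodCorner (A B : Matrix (Fin n) (Fin n) ℕ) (i j : ℕ) {k : ℕ} (hk : k ≤ n) :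
    corner A i k + corner B k j - corner B k n ≤ prodCorner A B i j :=
  le_sup' (fun k => corner A i k + corner B k j - corner B k n)
    (mem_range.2 (Nat.lt_succ_of_le hk))

lemma prodCorner_le {i j : ℕ} {x : ℤ}
    (h : ∀ k ≤ n, corner A i k + corner B k j - corner B k n ≤ x) : prodCorner A B i j ≤ x :=
  sup'_le _ _ fun k hk => h k (Nat.le_of_lt_succ (mem_range.1 hk))

lemma exists_prodCorner (A B : Matrix (Fin n) (Fin n) ℕ) (i j : ℕ) :
    ∃ k ≤ n, prodCorner A B i j = corner A i k + corner B k j - corner B k n := by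
  obtain ⟨k, hk, h⟩ := exists_mem_eq_sup' (nonempty_range_add_one (n := n))
    (fun k => corner A i k + corner B k j - corner B k n)
  exact ⟨k, Nat.le_of_lt_succ (mem_range.1 hk), h⟩

lemma prodCorner_zero_left (j : ℕ) : prodCorner A B 0 j = 0 := by
  apply le_antisymm
  · refine prodCorner_le fun k _ => ?_
    have := corner_le_n_right B k j
    rw [corner_zero_left]; linarith
  · have := le_prodCorner A B 0 j (Nat.zero_le n)
    simpa [corner_zero_left] using this

lemma prodCorner_zero_right (h : co A = ro B) (i : ℕ) : prodCorner A B i 0 = 0 := by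
  apply le_antisymm
  · refine prodCorner_le fun k _ => ?_
    have := corner_le_n_left A i k
    rw [corner_zero_right, ← corner_compat h]; linarith
  · have := le_prodCorner A B i 0 (Nat.zero_le n)
    simpa [corner_zero_left, corner_zero_right] using this

lemma prodCorner_n_left (h : co A = ro B) (j : ℕ) : prodCorner A B n j = corner B n j := by
  apply le_antisymm
  · refine prodCorner_le fun k _ => ?_
    have := corner_le_n_left B k j
    rw [corner_compat h]; linarith
  · have := le_prodCorner A B n j le_rfl
    rw [corner_compat h] at this; linarith

lemma prodCorner_n_right (i : ℕ) : prodCorner A B i n = corner A i n := by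
  apply le_antisymm
  · refine prodCorner_le fun k _ => ?_
    have := corner_le_n_right A i k
    linarith
  · have := le_prodCorner A B i n le_rfl
    linarith

lemma prodCorner_sat_left {i : ℕ} (hi : n ≤ i) (j : ℕ) :
    prodCorner A B i j = prodCorner A B n j := by
  unfold prodCorner
  congr 1
  funext k
  rw [corner_sat_left A hi]

lemma prodCorner_sat_right (i : ℕ) {j : ℕ} (hj : n ≤ j) :
    prodCorner A B i j = prodCorner A B i n := by
  unfold prodCorner
  congr 1
  funext k
  rw [corner_sat_right B k hj]

lemma prodCorner_super (A B : Matrix (Fin n) (Fin n) ℕ) (i j : ℕ) :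
    prodCorner A B (i + 1) j + prodCorner A B i (j + 1) ≤
      prodCorner A B (i + 1) (j + 1) + prodCorner A B i j := by
  obtain ⟨k, hk, h⟩ := exists_prodCorner A B (i + 1) j
  obtain ⟨k', hk', h'⟩ := exists_prodCorner A B i (j + 1)
  rw [h, h']
  rcases le_total k k' with hkk | hkk
  · have h1 := le_prodCorner A B (i + 1) (j + 1) hk'
    have h2 := le_prodCorner A B i j hk
    have h3 := corner_super A (Nat.le_succ i) hkk
    simp only [Nat.succ_eq_add_one] at h3
    linarith
  · have h1 := le_prodCorner A B (i + 1) (j + 1) hk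
    have h2 := le_prodCorner A B i j hk'
    have h3 := corner_super B hkk (Nat.le_succ j)
    simp only [Nat.succ_eq_add_one] at h3
    linarith

lemma entry_mulMat (A B : Matrix (Fin n) (Fin n) ℕ) (i j : ℕ) : entry (mulMat A B) i j =
    prodCorner A B (i + 1) (j + 1) + prodCorner A B i j
      - prodCorner A B (i + 1) j - prodCorner A B i (j + 1) := by
  unfold entry
  split_ifs with h
  · have := prodCorner_super A B i j
    simp only [mulMat]
    rw [Int.toNat_of_nonneg (by linarith)]
  · rcases not_and_or.1 h with h | h
    · have h : n ≤ i := not_lt.1 h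
      rw [prodCorner_sat_left h, prodCorner_sat_left h, prodCorner_sat_left (Nat.le_succ_of_le h),
        prodCorner_sat_left (Nat.le_succ_of_le h)]
      ring
    · have h : n ≤ j := not_lt.1 h
      rw [prodCorner_sat_right _ h, prodCorner_sat_right _ h,
        prodCorner_sat_right _ (Nat.le_succ_of_le h), prodCorner_sat_right _ (Nat.le_succ_of_le h)]
      ring

lemma corner_mulMat (h : co A = ro B) (i j : ℕ) :
    corner (mulMat A B) i j = prodCorner A B i j := by
  have hrow : ∀ k, ∑ l ∈ range j, entry (mulMat A B) k l =
      prodCorner A B (k + 1) j - prodCorner A B k j := by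
    intro k
    induction j with
    | zero => simp [prodCorner_zero_right h]
    | succ j ih => rw [sum_range_succ, ih, entry_mulMat]; ring
  unfold corner
  simp only [hrow]
  rw [sum_range_sub (fun k => prodCorner A B k j), prodCorner_zero_left, sub_zero]

lemma ro_mulMat (h : co A = ro B) : ro (mulMat A B) = ro A :=
  ro_eq_of_corner _ _ fun i => by rw [corner_mulMat h, prodCorner_n_right]

lemma co_mulMat (h : co A = ro B) : co (mulMat A B) = co B :=
  co_eq_of_corner _ _ fun j => by rw [corner_mulMat h, prodCorner_n_left h]

lemma mulMat_assoc (h : co A = ro B) (h' : co B = ro C) :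
    mulMat (mulMat A B) C = mulMat A (mulMat B C) := by
  have h1 : co (mulMat A B) = ro C := (co_mulMat h).trans h'
  have h2 : co A = ro (mulMat B C) := h.trans (ro_mulMat h').symm
  refine corner_inj _ _ fun i j => ?_
  rw [corner_mulMat h1, corner_mulMat h2]
  apply le_antisymm
  · refine prodCorner_le fun k hk => ?_
    rw [corner_mulMat h]
    obtain ⟨l, hl, e⟩ := exists_prodCorner A B i k
    have h3 := le_prodCorner A (mulMat B C) i j hl
    have h4 := le_prodCorner B C l j hk
    rw [corner_mulMat h', corner_mulMat h', prodCorner_n_right] at h3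
    linarith
  · refine prodCorner_le fun l hl => ?_
    rw [corner_mulMat h', corner_mulMat h', prodCorner_n_right]
    obtain ⟨k, hk, e⟩ := exists_prodCorner B C l j
    have h3 := le_prodCorner (mulMat A B) C i j hk
    have h4 := le_prodCorner A B i k hl
    rw [corner_mulMat h] at h3
    linarith

lemma ro_diagonal (l : Fin n → ℕ) : ro (Matrix.diagonal l) = l := by
  ext i; simp [ro, Matrix.diagonal_apply]

lemma co_diagonal (l : Fin n → ℕ) : co (Matrix.diagonal l) = l := by
  ext i; simp [co, Matrix.diagonal_apply]

lemma corner_diagonal (l : Fin n → ℕ) (i j : ℕ) : corner (Matrix.diagonal l) i j =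
    ∑ k ∈ range (min i j), (if h : k < n then (l ⟨k, h⟩ : ℤ) else 0) := by
  have he : ∀ k m, entry (Matrix.diagonal l) k m =
      if k = m then (if h : k < n then (l ⟨k, h⟩ : ℤ) else 0) else 0 := by
    intro k m
    unfold entry
    by_cases hk : k < n <;> by_cases hm : m < n <;> by_cases e : k = m <;>
      simp_all
  have hf : (range i).filter (fun k => k < j) = range (min i j) := by
    ext k; simp
  unfold corner
  simp only [he, sum_ite_eq, mem_range]
  rw [← sum_filter, hf]

lemma corner_diagonal_ro (A : Matrix (Fin n) (Fin n) ℕ) {i j : ℕ} (h : min i j ≤ n) :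
    corner (Matrix.diagonal (ro A)) i j = corner A (min i j) n := by
  rw [corner_diagonal, corner_row A _ h]

lemma corner_diagonal_co (A : Matrix (Fin n) (Fin n) ℕ) {i j : ℕ} (h : min i j ≤ n) :
    corner (Matrix.diagonal (co A)) i j = corner A n (min i j) := by
  rw [corner_diagonal, corner_col A _ h]

lemma diagonal_mulMat (A : Matrix (Fin n) (Fin n) ℕ) :
    mulMat (Matrix.diagonal (ro A)) A = A := by
  refine corner_inj _ _ fun i j => ?_
  rw [corner_mulMat (co_diagonal _)]
  apply le_antisymm
  · refine prodCorner_le fun k hk => ?_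
    rw [corner_diagonal_ro A ((min_le_right _ _).trans hk)]
    rcases le_total i k with h | h
    · rw [min_eq_left h]
      have h1 := corner_super A h (le_max_left j n)
      rw [corner_sat_right A _ (le_max_right j n), corner_sat_right A _ (le_max_right j n)] at h1
      linarith
    · rw [min_eq_right h]
      have := corner_mono_left A h j
      linarith
  · have h1 := le_prodCorner (Matrix.diagonal (ro A)) A i j (min_le_right i n)
    rw [corner_diagonal_ro A (by omega), min_eq_right (min_le_left i n)] at h1
    rcases le_total i n with h | h
    · rw [min_eq_left h] at h1; linarith
    · rw [min_eq_right h] at h1; rw [corner_sat_left A h]; linarith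

lemma mulMat_diagonal (A : Matrix (Fin n) (Fin n) ℕ) :
    mulMat A (Matrix.diagonal (co A)) = A := by
  have hc : co A = ro (Matrix.diagonal (co A)) := (ro_diagonal _).symm
  refine corner_inj _ _ fun i j => ?_
  rw [corner_mulMat hc]
  apply le_antisymm
  · refine prodCorner_le fun k hk => ?_
    rw [corner_diagonal_co A ((min_le_left _ _).trans hk), ← corner_compat hc]
    rcases le_total j k with h | h
    · rw [min_eq_right h]
      have h1 := corner_super A (le_max_left i n) h
      rw [corner_sat_left A (le_max_right i n), corner_sat_left A (le_max_right i n)] at h1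
      linarith
    · rw [min_eq_left h]
      have := corner_mono_right A i h
      linarith
  · have h1 := le_prodCorner A (Matrix.diagonal (co A)) i j (min_le_right j n)
    rw [corner_diagonal_co A (by omega), min_eq_left (min_le_left j n), ← corner_compat hc] at h1
    rcases le_total j n with h | h
    · rw [min_eq_left h] at h1; linarith
    · rw [min_eq_right h] at h1; rw [corner_sat_right A _ h]; linarith

lemma sum_mulMat (h : co A = ro B) :
    ∑ i, ∑ j, mulMat A B i j = ∑ i, ∑ j, A i j :=
  sum_congr rfl fun i _ => congrFun (ro_mulMat h) i

end mul

/-! ### The `0`-Schur algebra over `ℂ` -/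

/-- The product of two composable elements of `M_n(r)`. -/
def Mat.mul {n r : ℕ} (A B : Mat n r) (h : co A.1 = ro B.1) : Mat n r :=
  ⟨mulMat A.1 B.1, (sum_mulMat h).trans A.2⟩

/-- The diagonal matrix `D_λ`. -/
def diagMat {n r : ℕ} (l : WComp n r) : Mat n r :=
  ⟨Matrix.diagonal l.1, by
    have : ∀ i, ∑ j, Matrix.diagonal l.1 i j = l.1 i := fun i => congrFun (ro_diagonal l.1) i
    simp only [this]; exact l.2⟩

/-- The row-sum vector of `A ∈ M_n(r)` as a weak composition of `r`. -/
def Mat.row {n r : ℕ} (A : Mat n r) : WComp n r := ⟨ro A.1, A.2⟩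

/-- The column-sum vector of `A ∈ M_n(r)` as a weak composition of `r`. -/
def Mat.col {n r : ℕ} (A : Mat n r) : WComp n r := ⟨co A.1, sum_comm.trans A.2⟩

noncomputable section

/-- The `0`-Schur algebra over `ℂ`, through its standard basis: the vector space with basis `e_A`,
`A ∈ M_n(r)` (the orbits of pairs of `n`-step flags in an `r`-dimensional space), where
`e_A e_B = e_C` for the open orbit `C` among those composed of `A` and `B`, if `co A = ro B`, and
`e_A e_B = 0` otherwise. The unit is `∑_λ k_λ`. The products `e_i e_A` and `f_i e_A`, which
determine the algebra structure, are computed in `eGen_mul_e_move`, `eGen_mul_e_zero`,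
`fGen_mul_e_move` and `fGen_mul_e_zero`, and `k_λ e_A` and `e_A k_λ` in `k_mul_e`, `e_mul_k`. -/
def Schur (n r : ℕ) : Type := Mat n r →₀ ℂ

namespace Schur

variable {n r : ℕ}

instance : AddCommGroup (Schur n r) := inferInstanceAs (AddCommGroup (Mat n r →₀ ℂ))

instance : Module ℂ (Schur n r) := inferInstanceAs (Module ℂ (Mat n r →₀ ℂ))

/-- The standard basis element `e_A`. -/
def e (A : Mat n r) : Schur n r := Finsupp.single A (1 : ℂ)

/-- The standard basis as a basis. -/
def basis (n r : ℕ) : Module.Basis (Mat n r) ℂ (Schur n r) :=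
  Module.Basis.ofRepr (LinearEquiv.refl ℂ (Mat n r →₀ ℂ))

lemma basis_apply (A : Mat n r) : basis n r A = e A := rfl

open Classical in
/-- The product `e_A e_B`: it is `e_C` if `co A = ro B`, and `0` otherwise. -/
def basisMul (A B : Mat n r) : Schur n r :=
  if h : co A.1 = ro B.1 then e (A.mul B h) else 0

/-- The bilinear multiplication. -/
def mulLin (n r : ℕ) : Schur n r →ₗ[ℂ] Schur n r →ₗ[ℂ] Schur n r :=
  (basis n r).constr ℂ fun A => (basis n r).constr ℂ fun B => basisMul A B

instance : Mul (Schur n r) := ⟨fun x y => mulLin n r x y⟩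

/-- The idempotent `k_λ = e_{D_λ}`. -/
def k (l : WComp n r) : Schur n r := e (diagMat l)

instance : One (Schur n r) := ⟨∑ l : WComp n r, k l⟩

lemma mul_def (x y : Schur n r) : x * y = mulLin n r x y := rfl

lemma one_def : (1 : Schur n r) = ∑ l : WComp n r, k l := rfl

lemma e_mul_e (A B : Mat n r) : e A * e B = basisMul A B := by
  rw [mul_def, ← basis_apply A, ← basis_apply B, mulLin, Module.Basis.constr_basis,
    Module.Basis.constr_basis]

lemma e_mul_e_of_eq {A B : Mat n r} (h : co A.1 = ro B.1) : e A * e B = e (A.mul B h) := by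
  rw [e_mul_e, basisMul, dif_pos h]

lemma e_mul_e_of_ne {A B : Mat n r} (h : co A.1 ≠ ro B.1) : e A * e B = 0 := by
  rw [e_mul_e, basisMul, dif_neg h]

lemma k_mul_e (l : WComp n r) (A : Mat n r) : k l * e A = if l = A.row then e A else 0 := by
  split_ifs with h
  · subst h
    rw [k, e_mul_e_of_eq (co_diagonal _)]
    exact congrArg e (Subtype.ext (diagonal_mulMat A.1))
  · exact e_mul_e_of_ne fun h' => h (Subtype.ext ((co_diagonal l.1).symm.trans h'))

lemma e_mul_k (l : WComp n r) (A : Mat n r) : e A * k l = if l = A.col then e A else 0 := by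
  split_ifs with h
  · subst h
    rw [k, e_mul_e_of_eq (ro_diagonal _).symm]
    exact congrArg e (Subtype.ext (mulMat_diagonal A.1))
  · exact e_mul_e_of_ne fun h' => h (Subtype.ext ((ro_diagonal l.1).symm.trans h'.symm))

lemma e_mul_assoc (A B C : Mat n r) : e A * e B * e C = e A * (e B * e C) := by
  by_cases h : co A.1 = ro B.1
  · by_cases h' : co B.1 = ro C.1
    · have h1 : co (A.mul B h).1 = ro C.1 := (co_mulMat h).trans h'
      have h2 : co A.1 = ro (B.mul C h').1 := h.trans (ro_mulMat h').symm
      rw [e_mul_e_of_eq h, e_mul_e_of_eq h', e_mul_e_of_eq h1, e_mul_e_of_eq h2]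
      exact congrArg e (Subtype.ext (mulMat_assoc h h'))
    · have h1 : co (A.mul B h).1 ≠ ro C.1 := fun h1 => h' ((co_mulMat h).symm.trans h1)
      rw [e_mul_e_of_eq h, e_mul_e_of_ne h', e_mul_e_of_ne h1, mul_def, map_zero]
  · rw [e_mul_e_of_ne h, mul_def 0, map_zero, LinearMap.zero_apply]
    by_cases h' : co B.1 = ro C.1
    · have h2 : co A.1 ≠ ro (B.mul C h').1 := fun h2 => h (h2.trans (ro_mulMat h'))
      rw [e_mul_e_of_eq h', e_mul_e_of_ne h2]
    · rw [e_mul_e_of_ne h', mul_def, map_zero]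

@[elab_as_elim]
lemma schur_induction {p : Schur n r → Prop} (x : Schur n r) (zero : p 0)
    (add : ∀ x y, p x → p y → p (x + y)) (smul : ∀ (c : ℂ) A, p (c • e A)) : p x := by
  refine Finsupp.induction_linear x zero add fun A c => ?_
  have : Finsupp.single A c = c • (Finsupp.single A 1 : Mat n r →₀ ℂ) := by
    rw [Finsupp.smul_single, smul_eq_mul, mul_one]
  rw [this]
  exact smul c A

instance : Ring (Schur n r) :=
  { (inferInstance : AddCommGroup (Schur n r)),
    (inferInstance : Mul (Schur n r)),
    (inferInstance : One (Schur n r)) with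
    left_distrib := fun x y z => by simp only [mul_def, map_add]
    right_distrib := fun x y z => by simp only [mul_def, map_add, LinearMap.add_apply]
    zero_mul := fun x => by simp only [mul_def, map_zero, LinearMap.zero_apply]
    mul_zero := fun x => by simp only [mul_def, map_zero]
    mul_assoc := fun x y z => by
      induction x using schur_induction with
      | zero => simp only [mul_def, map_zero, LinearMap.zero_apply]
      | add x x' hx hx' =>
        simp only [mul_def, map_add, LinearMap.add_apply] at hx hx' ⊢; rw [hx, hx']
      | smul c A =>
      induction y using schur_induction with
      | zero => simp only [mul_def, map_zero, LinearMap.zero_apply]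
      | add y y' hy hy' =>
        simp only [mul_def, map_add, LinearMap.add_apply] at hy hy' ⊢; rw [hy, hy']
      | smul c' B =>
      induction z using schur_induction with
      | zero => simp only [mul_def, map_zero]
      | add z z' hz hz' =>
        simp only [mul_def, map_add] at hz hz' ⊢; rw [hz, hz']
      | smul c'' C =>
        have := e_mul_assoc A B C
        simp only [mul_def, map_smul, LinearMap.smul_apply] at this ⊢
        rw [this]
    one_mul := fun x => by
      have h : mulLin n r 1 = LinearMap.id := (basis n r).ext fun A => by
        have := fun l => k_mul_e l A
        simp only [mul_def] at this
        rw [one_def, map_sum, LinearMap.sum_apply, basis_apply]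
        simp [this]
      simp only [mul_def, h, LinearMap.id_apply]
    mul_one := fun x => by
      have h : (mulLin n r).flip 1 = LinearMap.id := (basis n r).ext fun A => by
        have := fun l => e_mul_k l A
        simp only [mul_def] at this
        rw [one_def, map_sum, LinearMap.sum_apply, basis_apply]
        simp [this]
      exact LinearMap.congr_fun h x }

instance : Algebra ℂ (Schur n r) :=
  Algebra.ofModule
    (fun c x y => by simp only [mul_def, map_smul, LinearMap.smul_apply])
    (fun c x y => by simp only [mul_def, map_smul])

/-- The row index `i` (the `i`-th row), for `i` in the index set `{1, …, n-1}` of the generators. -/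
def row₁ (i : Fin (n - 1)) : Fin n := ⟨i, by omega⟩

/-- The row index `i + 1`, for `i` in the index set `{1, …, n-1}` of the generators. -/
def row₂ (i : Fin (n - 1)) : Fin n := ⟨i + 1, by omega⟩

lemma sum_single (t c : Fin n) :
    ∑ i, ∑ j, (Matrix.single t c 1 : Matrix (Fin n) (Fin n) ℕ) i j = 1 := by
  simp [Matrix.single_apply, ite_and, Finset.sum_ite_eq]

lemma single_le {A : Matrix (Fin n) (Fin n) ℕ} {s c : Fin n} (h : 0 < A s c) (i j : Fin n) :
    (Matrix.single s c 1 : Matrix (Fin n) (Fin n) ℕ) i j ≤ A i j := by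
  rw [Matrix.single_apply]
  split_ifs with hh
  · obtain ⟨rfl, rfl⟩ := hh; exact h
  · exact Nat.zero_le _

lemma sum_move {A : Matrix (Fin n) (Fin n) ℕ} {s c : Fin n} (t : Fin n) (h : 0 < A s c) :
    ∑ i, ∑ j, (A - Matrix.single s c 1 + Matrix.single t c 1 : Matrix (Fin n) (Fin n) ℕ) i j = ∑ i, ∑ j, A i j := by
  have h1 : ∑ i, ∑ j, (A - Matrix.single s c 1 + Matrix.single t c 1 : Matrix (Fin n) (Fin n) ℕ) i j =
      ∑ i, ∑ j, (A - Matrix.single s c 1 : Matrix (Fin n) (Fin n) ℕ) i j + 1 := by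
    simp only [Matrix.add_apply, sum_add_distrib, sum_single]
  have h2 : ∑ i, ∑ j, (A - Matrix.single s c 1 : Matrix (Fin n) (Fin n) ℕ) i j + 1 =
      ∑ i, ∑ j, A i j := by
    refine (congrArg (_ + ·) (sum_single s c).symm).trans ?_
    simp only [← sum_add_distrib]
    exact sum_congr rfl fun i _ => sum_congr rfl fun j _ => Nat.sub_add_cancel (single_le h i j)
  exact h1.trans h2

/-- `A - E_{s,c} + E_{t,c}` for an entry `a_{s,c} > 0`: one unit of column `c` moves from row `s`
to row `t`. -/
def move (A : Mat n r) (s t c : Fin n) (h : 0 < A.1 s c) : Mat n r :=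
  ⟨A.1 - Matrix.single s c 1 + Matrix.single t c 1, (sum_move t h).trans A.2⟩

lemma diagMat_pos {l : WComp n r} {s : Fin n} (h : 0 < l.1 s) : 0 < (diagMat l).1 s s := by
  simpa [diagMat] using h

/-- `e_{i,λ}`, the basis element at `D_λ - E_{i+1,i+1} + E_{i,i+1}`; it is zero if
`λ_{i+1} = 0`, when this matrix has a negative entry. -/
def eGenAt (i : Fin (n - 1)) (l : WComp n r) : Schur n r :=
  if h : 0 < l.1 (row₂ i) then e (move (diagMat l) (row₂ i) (row₁ i) (row₂ i) (diagMat_pos h))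
  else 0

/-- `f_{i,λ}`, the basis element at `D_λ - E_{i,i} + E_{i+1,i}`; it is zero if `λ_i = 0`, when
this matrix has a negative entry. -/
def fGenAt (i : Fin (n - 1)) (l : WComp n r) : Schur n r :=
  if h : 0 < l.1 (row₁ i) then e (move (diagMat l) (row₁ i) (row₂ i) (row₁ i) (diagMat_pos h))
  else 0

/-- The generator `e_i = ∑_λ e_{i,λ}`. -/
def eGen (i : Fin (n - 1)) : Schur n r := ∑ l : WComp n r, eGenAt i l

/-- The generator `f_i = ∑_λ f_{i,λ}`. -/
def fGen (i : Fin (n - 1)) : Schur n r := ∑ l : WComp n r, fGenAt i l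

/-! The next facts are the multiplication rules for `e_i e_A` and `f_i e_A`. -/

lemma entry_move (A : Mat n r) (s t c : Fin n) (h : 0 < A.1 s c) (k l : ℕ) :
    entry (move A s t c h).1 k l = entry A.1 k l
      - (if k = s then if l = c then 1 else 0 else 0)
      + (if k = t then if l = c then 1 else 0 else 0) := by
  by_cases hh : k < n ∧ l < n
  · have h1 := single_le h ⟨k, hh.1⟩ ⟨l, hh.2⟩
    have h2 : (move A s t c h).1 ⟨k, hh.1⟩ ⟨l, hh.2⟩ = A.1 ⟨k, hh.1⟩ ⟨l, hh.2⟩ -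
      (Matrix.single s c 1 : Matrix (Fin n) (Fin n) ℕ) ⟨k, hh.1⟩ ⟨l, hh.2⟩ +
      (Matrix.single t c 1 : Matrix (Fin n) (Fin n) ℕ) ⟨k, hh.1⟩ ⟨l, hh.2⟩ := rfl
    have h3 : ∀ s : Fin n,
        (((Matrix.single s c 1 : Matrix (Fin n) (Fin n) ℕ) ⟨k, hh.1⟩ ⟨l, hh.2⟩ : ℕ) : ℤ) =
        if k = s then if l = c then 1 else 0 else 0 := by
      intro s
      rw [Matrix.single_apply, ← ite_and]
      simp only [Fin.ext_iff, eq_comm (a := (s : ℕ)), eq_comm (a := (c : ℕ))]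
      push_cast
      rfl
    rw [entry, dif_pos hh, entry, dif_pos hh, ← h3, ← h3, h2]
    push_cast [Nat.cast_sub h1]
    rfl
  · have h1 : ∀ s : Fin n, (if k = s then if l = c then (1 : ℤ) else 0 else 0) = 0 := by
      intro s
      split_ifs with h4 h5
      · exact absurd ⟨h4 ▸ s.2, h5 ▸ c.2⟩ hh
      · rfl
      · rfl
    rw [entry, dif_neg hh, entry, dif_neg hh, h1, h1]; rfl

lemma corner_move (A : Mat n r) (s t c : Fin n) (h : 0 < A.1 s c) (i j : ℕ) :
    corner (move A s t c h).1 i j = corner A.1 i j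
      - (if (s : ℕ) < i then if (c : ℕ) < j then 1 else 0 else 0)
      + (if (t : ℕ) < i then if (c : ℕ) < j then 1 else 0 else 0) := by
  have h1 : ∀ s c : ℕ, ∑ k ∈ range i, ∑ l ∈ range j,
      (if k = s then if l = c then (1 : ℤ) else 0 else 0) =
      if s < i then if c < j then 1 else 0 else 0 := by
    intro s c
    have h2 : ∀ k, ∑ l ∈ range j, (if k = s then if l = c then (1 : ℤ) else 0 else 0) =
        if k = s then if c < j then 1 else 0 else 0 := by
      intro k
      split_ifs with h3 h4 <;> simp_all
    simp only [h2, sum_ite_eq', mem_range]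
  simp only [corner, entry_move, sum_add_distrib, sum_sub_distrib, h1]

lemma ro_move_diagonal_ne {l : WComp n r} {s t c : Fin n} (h : 0 < (diagMat l).1 s c)
    {A : Mat n r} (hl : l ≠ A.row) : co (move (diagMat l) s t c h).1 ≠ ro A.1 := by
  intro h'
  refine hl (Subtype.ext ((co_diagonal l.1).symm.trans (Eq.trans ?_ h')))
  refine (co_eq_of_corner _ _ fun j => ?_).symm
  rw [corner_move, if_pos s.2, if_pos t.2, sub_add_cancel]
  rfl

lemma co_move_diagonal {A : Mat n r} {s t c : Fin n} (h : 0 < (diagMat A.row).1 s c) :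
    co (move (diagMat A.row) s t c h).1 = ro A.1 := by
  refine Eq.trans (co_eq_of_corner _ _ fun j => ?_) (co_diagonal _)
  rw [corner_move, if_pos s.2, if_pos t.2, sub_add_cancel]
  rfl

lemma eGen_mul_e (i : Fin (n - 1)) (A : Mat n r) :
    eGen i * e A = eGenAt i A.row * e A := by
  rw [eGen, sum_mul]
  refine sum_eq_single A.row (fun l _ hl => ?_) fun h => absurd (mem_univ _) h
  unfold eGenAt
  split_ifs with h
  · exact e_mul_e_of_ne (ro_move_diagonal_ne _ hl)
  · rw [zero_mul]

lemma fGen_mul_e (i : Fin (n - 1)) (A : Mat n r) :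
    fGen i * e A = fGenAt i A.row * e A := by
  rw [fGen, sum_mul]
  refine sum_eq_single A.row (fun l _ hl => ?_) fun h => absurd (mem_univ _) h
  unfold fGenAt
  split_ifs with h
  · exact e_mul_e_of_ne (ro_move_diagonal_ne _ hl)
  · rw [zero_mul]

/-- If row `i + 1` of `A` is zero, then `e_i e_A = 0`. -/
lemma eGen_mul_e_zero (i : Fin (n - 1)) (A : Mat n r) (h : ro A.1 (row₂ i) = 0) :
    eGen i * e A = 0 := by
  rw [eGen_mul_e, eGenAt, dif_neg (by simpa [Mat.row] using h), zero_mul]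

/-- If row `i` of `A` is zero, then `f_i e_A = 0`. -/
lemma fGen_mul_e_zero (i : Fin (n - 1)) (A : Mat n r) (h : ro A.1 (row₁ i) = 0) :
    fGen i * e A = 0 := by
  rw [fGen_mul_e, fGenAt, dif_neg (by simpa [Mat.row] using h), zero_mul]

lemma prodCorner_diag (A : Mat n r) (s j : ℕ) :
    prodCorner (diagMat A.row).1 A.1 s j = corner A.1 s j :=
  (corner_mulMat (co_diagonal _) s j).symm.trans (by
    rw [diagonal_mulMat A.1])

lemma diag_bound (A : Mat n r) (s j : ℕ) {k : ℕ} (hk : k ≤ n) :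
    corner (diagMat A.row).1 s k + corner A.1 k j - corner A.1 k n ≤ corner A.1 s j := by
  have h := le_prodCorner (diagMat A.row).1 A.1 s j hk
  rwa [prodCorner_diag] at h

lemma diag_attained (A : Mat n r) (s j : ℕ) : ∃ k ≤ n,
    corner (diagMat A.row).1 s k + corner A.1 k j - corner A.1 k n = corner A.1 s j := by
  obtain ⟨k, hk, h⟩ := exists_prodCorner (diagMat A.row).1 A.1 s j
  rw [prodCorner_diag] at h
  exact ⟨k, hk, h.symm⟩

lemma corner_diag (A : Mat n r) {s k : ℕ} (h : min s k ≤ n) :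
    corner (diagMat A.row).1 s k = corner A.1 (min s k) n := corner_diagonal_ro A.1 h

/-- If the last nonzero entry of row `i + 1` of `A` is in column `p`, then
`e_i e_A = e_B` with `B = A + E_{i,p} - E_{i+1,p}`. -/
lemma eGen_mul_e_move (i : Fin (n - 1)) (A : Mat n r) (p : Fin n) (hp : 0 < A.1 (row₂ i) p)
    (hmax : ∀ j, p < j → A.1 (row₂ i) j = 0) :
    eGen i * e A = e (move A (row₂ i) (row₁ i) p hp) := by
  have hpos : 0 < A.row.1 (row₂ i) :=
    lt_of_lt_of_le hp (single_le_sum (f := fun j => A.1 (row₂ i) j) (fun _ _ => Nat.zero_le _)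
      (mem_univ p))
  rw [eGen_mul_e, eGenAt, dif_pos hpos, e_mul_e_of_eq (co_move_diagonal _)]
  refine congrArg e (Subtype.ext (corner_inj _ _ fun s j => ?_))
  have hi : (i : ℕ) + 1 < n := by omega
  have key : ∀ k, corner (move (diagMat A.row) (row₂ i) (row₁ i) (row₂ i)
      (diagMat_pos hpos)).1 s k = corner (diagMat A.row).1 s k +
        if s = i + 1 ∧ i + 1 < k then 1 else 0 := by
    intro k
    rw [corner_move]
    simp only [row₁, row₂]
    split_ifs <;> omega
  have goal : corner (move A (row₂ i) (row₁ i) p hp).1 s j = corner A.1 s j +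
        if s = i + 1 ∧ (p : ℕ) < j then 1 else 0 := by
    rw [corner_move]
    simp only [row₁, row₂]
    split_ifs <;> omega
  refine (corner_mulMat (co_move_diagonal _) s j).trans ?_
  rw [goal]
  apply le_antisymm
  · refine prodCorner_le fun k hk => ?_
    rw [key]
    have hb := diag_bound A s j hk
    by_cases hs : s = i + 1 ∧ (i : ℕ) + 1 < k
    · rw [if_pos hs]
      by_cases hj : (p : ℕ) < j
      · rw [if_pos ⟨hs.1, hj⟩]; linarith
      · rw [if_neg fun h => hj h.2]
        have hjn : j ≤ n := by omega
        have hsk : s ≤ k := by omega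
        have h1 := corner_super A.1 hsk hjn
        have h2 := (rect_eq_zero_iff A.1 hsk hjn).not.2 fun h => by
          have := h (row₂ i) p (by simp [row₂, hs.1]) (by simp [row₂, hs.2]) (by omega) p.2
          omega
        rw [corner_diag A (by omega), min_eq_left hsk]
        omega
    · rw [if_neg hs]
      split_ifs <;> linarith
  · by_cases hs : s = i + 1 ∧ (p : ℕ) < j
    · rw [if_pos hs]
      obtain ⟨rfl, hj⟩ := hs
      have h1 := le_prodCorner (move (diagMat A.row) (row₂ i) (row₁ i) (row₂ i)
        (diagMat_pos hpos)).1 A.1 (i + 1) j (k := i + 2) (by omega)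
      rw [key, if_pos ⟨rfl, by omega⟩, corner_diag A (by omega), min_eq_left (by omega)] at h1
      refine le_trans ?_ h1
      rcases le_total j n with hjn | hjn
      · have h2 := (rect_eq_zero_iff A.1 (Nat.le_succ (i + 1)) hjn).2 fun a b ha ha' hb hb' => by
          have : a = row₂ i := Fin.ext (by simp only [row₂]; omega)
          subst this
          exact hmax b (Fin.lt_def.2 (by omega))
        simp only [Nat.succ_eq_add_one] at h2
        have : (i : ℕ) + 1 + 1 = i + 2 := rfl
        rw [this] at h2
        omega
      · rw [corner_sat_right A.1 _ hjn, corner_sat_right A.1 _ hjn]; omega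
    · rw [if_neg hs]
      obtain ⟨k, hk, h⟩ := diag_attained A s j
      have h1 := le_prodCorner (move (diagMat A.row) (row₂ i) (row₁ i) (row₂ i)
        (diagMat_pos hpos)).1 A.1 s j hk
      rw [key] at h1
      split_ifs at h1 <;> omega

/-- If the first nonzero entry of row `i` of `A` is in column `q`, then
`f_i e_A = e_B` with `B = A - E_{i,q} + E_{i+1,q}`. -/
lemma fGen_mul_e_move (i : Fin (n - 1)) (A : Mat n r) (q : Fin n) (hq : 0 < A.1 (row₁ i) q)
    (hmin : ∀ j, j < q → A.1 (row₁ i) j = 0) :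
    fGen i * e A = e (move A (row₁ i) (row₂ i) q hq) := by
  have hpos : 0 < A.row.1 (row₁ i) :=
    lt_of_lt_of_le hq (single_le_sum (f := fun j => A.1 (row₁ i) j) (fun _ _ => Nat.zero_le _)
      (mem_univ q))
  rw [fGen_mul_e, fGenAt, dif_pos hpos, e_mul_e_of_eq (co_move_diagonal _)]
  refine congrArg e (Subtype.ext (corner_inj _ _ fun s j => ?_))
  have hi : (i : ℕ) + 1 < n := by omega
  have key : ∀ k, corner (move (diagMat A.row) (row₁ i) (row₂ i) (row₁ i)
      (diagMat_pos hpos)).1 s k = corner (diagMat A.row).1 s k -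
        if s = i + 1 ∧ (i : ℕ) < k then 1 else 0 := by
    intro k
    rw [corner_move]
    simp only [row₁, row₂]
    split_ifs <;> omega
  have goal : corner (move A (row₁ i) (row₂ i) q hq).1 s j = corner A.1 s j -
        if s = i + 1 ∧ (q : ℕ) < j then 1 else 0 := by
    rw [corner_move]
    simp only [row₁, row₂]
    split_ifs <;> omega
  refine (corner_mulMat (co_move_diagonal _) s j).trans ?_
  rw [goal]
  apply le_antisymm
  · refine prodCorner_le fun k hk => ?_
    rw [key]
    have hb := diag_bound A s j hk
    by_cases hs : s = i + 1 ∧ (q : ℕ) < j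
    · rw [if_pos hs]
      by_cases hk' : (i : ℕ) < k
      · rw [if_pos ⟨hs.1, hk'⟩]; linarith
      · rw [if_neg fun h => hk' h.2]
        have hks : k ≤ s := by omega
        have h1 := corner_mono_left A.1 hks j
        have h2 := (rect_eq_zero_iff A.1 hks (Nat.zero_le j)).not.2 fun h => by
          have := h (row₁ i) q (by simp only [row₁]; omega) (by simp only [row₁]; omega)
            (Nat.zero_le _) hs.2
          omega
        rw [corner_zero_right, corner_zero_right] at h2
        rw [corner_diag A (by omega), min_eq_right hks]
        omega
    · rw [if_neg hs]
      split_ifs <;> linarith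
  · by_cases hs : s = i + 1 ∧ ¬ (q : ℕ) < j
    · obtain ⟨rfl, hj⟩ := hs
      rw [if_neg fun h => hj h.2]
      have h1 := le_prodCorner (move (diagMat A.row) (row₁ i) (row₂ i) (row₁ i)
        (diagMat_pos hpos)).1 A.1 (i + 1) j (k := i) (by omega)
      rw [key, if_neg (by omega), corner_diag A (by omega), min_eq_right (by omega)] at h1
      have h2 := (rect_eq_zero_iff A.1 (Nat.le_succ i) (Nat.zero_le j)).2
        fun a b ha ha' hb hb' => by
          have : a = row₁ i := Fin.ext (by simp only [row₁]; omega)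
          subst this
          exact hmin b (Fin.lt_def.2 (by omega))
      rw [corner_zero_right, corner_zero_right] at h2
      simp only [Nat.succ_eq_add_one] at h2
      omega
    · obtain ⟨k, hk, h⟩ := diag_attained A s j
      have h1 := le_prodCorner (move (diagMat A.row) (row₁ i) (row₂ i) (row₁ i)
        (diagMat_pos hpos)).1 A.1 s j hk
      rw [key] at h1
      split_ifs at h1 ⊢ <;> omega

end Schur

/-! ### The modules `P_λ`, `N_λ` and `S_λ` -/

open Schur

variable {n r : ℕ}

/-- `α` is maximal with respect to `λ`: each of the consecutive subsequences into which `α` cuts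
`λ` is either `(0)`, or has neither its first nor its last entry equal to zero. -/
def IsMaximal (l : WComp n r) (α : Composition n) : Prop :=
  ∀ v : Fin α.length,
    (α.blocksFun v = 1 ∧ ∀ t, l.1 (α.embedding v t) = 0) ∨
    ((∀ t : Fin (α.blocksFun v), (t : ℕ) = 0 → l.1 (α.embedding v t) ≠ 0) ∧
      (∀ t : Fin (α.blocksFun v), (t : ℕ) + 1 = α.blocksFun v → l.1 (α.embedding v t) ≠ 0))

/-- The matrix `A(α;v)`: the columns of `A` in the `v`-th block of `α`, the other ones being
replaced by zero. -/
def colPart (A : Matrix (Fin n) (Fin n) ℕ) (α : Composition n) (v : Fin α.length) :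
    Matrix (Fin n) (Fin n) ℕ := fun i j =>
  if α.sizeUpTo v ≤ j ∧ (j : ℕ) < α.sizeUpTo (v + 1) then A i j else 0

/-- Open matrices: every `2 × 2` submatrix has at least one zero on its diagonal. -/
def IsOpenMat (A : Matrix (Fin n) (Fin n) ℕ) : Prop :=
  ∀ i i' j j' : Fin n, i < i' → j < j' → A i j = 0 ∨ A i' j' = 0

/-- `A` is open on columns with respect to `α`. -/
def IsOpenOnColumns (A : Matrix (Fin n) (Fin n) ℕ) (α : Composition n) : Prop :=
  ∀ v, IsOpenMat (colPart A α v)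

/-- The index set of `B^{λ,α}`: the matrices `A` with `co A = λ` that are open on columns with
respect to `α`. -/
def openSet (l : WComp n r) (α : Composition n) : Set (Mat n r) :=
  {A | co A.1 = l.1 ∧ IsOpenOnColumns A.1 α}

/-- The index set of `B^λ`: the matrices `A` with `co A = λ` such that `A` is not in the index set
of `B^{λ,α}` for any `α ≠ (1,…,1)` maximal with respect to `λ`. -/
def BSet (l : WComp n r) : Set (Mat n r) :=
  {A | co A.1 = l.1} \ ⋃ α ∈ {α : Composition n | IsMaximal l α} \ {Composition.ones n}, openSet l α

/-- Column block diagonal matrices. -/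
def IsColumnBlockDiagonal (A : Matrix (Fin n) (Fin n) ℕ) : Prop :=
  ∀ i j, 0 < A i j → ∀ s t, s ≤ i → j < t → A s t = 0

/-- `CB(λ)`: column block diagonal matrices with column-sum vector `λ`. -/
def CB (l : WComp n r) : Set (Mat n r) :=
  {A | IsColumnBlockDiagonal A.1 ∧ co A.1 = l.1}

/-- If `e_X e_A = e_C` with `C` column block diagonal, then `A` is column block diagonal. -/
lemma IsColumnBlockDiagonal.of_mulMat {X A : Matrix (Fin n) (Fin n) ℕ} (h : co X = ro A)
    (hC : IsColumnBlockDiagonal (mulMat X A)) : IsColumnBlockDiagonal A := by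
  intro i j hij s t hs ht
  -- a row cut of `C` adapted to the column cut `j + 1`
  obtain ⟨i₀, hi₀, h1, h2⟩ : ∃ i₀ ≤ n,
      (∀ a b : Fin n, i₀ ≤ a → (b : ℕ) < j + 1 → mulMat X A a b = 0) ∧
      (∀ a b : Fin n, (a : ℕ) < i₀ → (j : ℕ) + 1 ≤ b → mulMat X A a b = 0) := by
    classical
    let S := univ.filter fun a : Fin n => ∃ b : Fin n, (b : ℕ) < j + 1 ∧ 0 < mulMat X A a b
    refine ⟨S.sup fun a => (a : ℕ) + 1, Finset.sup_le fun a _ => a.2, ?_, ?_⟩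
    · intro a b ha hb
      by_contra hne
      have hmem : a ∈ S := mem_filter.2 ⟨mem_univ _, b, hb, Nat.pos_of_ne_zero hne⟩
      have := Finset.le_sup (f := fun a : Fin n => (a : ℕ) + 1) hmem
      omega
    · intro a b ha hb
      obtain ⟨a', ha', hlt⟩ := (Finset.lt_sup_iff).1 ha
      obtain ⟨b', hb', hpos⟩ := (mem_filter.1 ha').2
      exact hC a' b' hpos a b (Fin.le_def.2 (by omega)) (Fin.lt_def.2 (by omega))
  have h1' := (rect_eq_zero_iff (mulMat X A) hi₀ (Nat.zero_le (j + 1))).2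
    fun a b ha _ _ hb => h1 a b ha hb
  have h2' := (rect_eq_zero_iff (mulMat X A) (Nat.zero_le i₀) (Nat.succ_le_of_lt j.2)).2
    fun a b _ ha hb _ => h2 a b ha hb
  simp only [Nat.succ_eq_add_one, corner_mulMat h, prodCorner_n_left h, prodCorner_zero_left,
    prodCorner_zero_right h, corner_zero_right] at h1' h2'
  obtain ⟨k, hk, hk'⟩ := exists_prodCorner X A i₀ (j + 1)
  have h3 := le_prodCorner X A i₀ n hk
  have h4 := corner_le_n_left X i₀ k
  rw [corner_compat h] at h4
  have h5 := corner_le_n_left A k (j + 1)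
  have h6 := corner_le_n_right A k (j + 1)
  have hik : (i : ℕ) < k := by
    by_contra hlt
    have := (rect_eq_zero_iff A hk (Nat.zero_le (j + 1))).1
      (by rw [corner_zero_right, corner_zero_right]; linarith) i j (not_lt.1 hlt) i.2
      (Nat.zero_le _) (Nat.lt_succ_self _)
    omega
  exact (rect_eq_zero_iff A (Nat.zero_le k) (Nat.succ_le_of_lt j.2)).1
    (by rw [corner_zero_left, corner_zero_left]; simp only [Nat.succ_eq_add_one]; linarith) s t
    (Nat.zero_le _) (lt_of_le_of_lt hs hik) ht t.2

lemma isOpenMat_colPart_iff (A : Matrix (Fin n) (Fin n) ℕ) (α : Composition n)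
    (v : Fin α.length) : IsOpenMat (colPart A α v) ↔
      ∀ i j, i ≤ n → α.sizeUpTo v ≤ j → j ≤ α.sizeUpTo (v + 1) →
        (corner A i j = corner A i (α.sizeUpTo v) ∨
          corner A i (α.sizeUpTo (v + 1)) - corner A i j =
            corner A n (α.sizeUpTo (v + 1)) - corner A n j) := by
  constructor
  · intro h i j hi hj hj'
    by_contra hne
    rw [not_or] at hne
    have h1 := (rect_eq_zero_iff A (Nat.zero_le i) hj).not.1
      (by simp only [corner_zero_left]; exact fun h' => hne.1 (by linarith))
    have h2 := (rect_eq_zero_iff A hi hj').not.1 fun h' => hne.2 (by linarith)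
    push Not at h1 h2
    obtain ⟨s, t, _, hs, ht, ht', hst⟩ := h1
    obtain ⟨s', t', hs', _, ht1, ht1', hst'⟩ := h2
    rcases h s s' t t' (Fin.lt_def.2 (by omega)) (Fin.lt_def.2 (by omega)) with h | h
    · rw [colPart, if_pos ⟨ht, by omega⟩] at h; exact hst h
    · rw [colPart, if_pos ⟨by omega, ht1'⟩] at h; exact hst' h
  · intro h i i' j j' hi hj
    rw [Fin.lt_def] at hi hj
    unfold colPart
    split_ifs with h1 h2
    · rcases h i' j' i'.2.le h2.1 h2.2.le with h | h
      · exact Or.inl ((rect_eq_zero_iff A (Nat.zero_le i') h2.1).1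
          (by simp only [corner_zero_left]; linarith) i j (Nat.zero_le _) hi h1.1 hj)
      · exact Or.inr ((rect_eq_zero_iff A i'.2.le h2.2.le).1
          (by linarith) i' j' le_rfl i'.2 le_rfl h2.2)
    · exact Or.inr rfl
    · exact Or.inl rfl
    · exact Or.inl rfl

/-- If `A` is open on columns and `e_X e_A = e_C`, then `C` is open on columns. -/
lemma IsOpenOnColumns.mulMat {X A : Matrix (Fin n) (Fin n) ℕ} (h : co X = ro A)
    {α : Composition n} (hA : IsOpenOnColumns A α) : IsOpenOnColumns (mulMat X A) α := by
  intro v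
  have hv := (isOpenMat_colPart_iff A α v).1 (hA v)
  rw [isOpenMat_colPart_iff]
  intro i j hi hj hj'
  have s1 := corner_mono_right (ZeroSchur.mulMat X A) i hj
  have s2 := corner_super (ZeroSchur.mulMat X A) hi hj'
  simp only [corner_mulMat h, prodCorner_n_left h] at s1 s2 ⊢
  obtain ⟨k, hk, hk'⟩ := exists_prodCorner X A i j
  rcases hv k j hk hj hj' with h1 | h1
  · left
    have := le_prodCorner X A i (α.sizeUpTo v) hk
    linarith
  · right
    have := le_prodCorner X A i (α.sizeUpTo (v + 1)) hk
    linarith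

/-- If `e_X e_A = e_C` with `C` in the index set of `B^λ`, then `A` is in it, too. -/
lemma BSet.of_mul {l : WComp n r} {X A : Mat n r} (h : co X.1 = ro A.1)
    (hC : X.mul A h ∈ BSet l) : A ∈ BSet l := by
  refine ⟨(co_mulMat h).symm.trans hC.1, fun hA => hC.2 ?_⟩
  simp only [Set.mem_iUnion] at hA ⊢
  obtain ⟨α, hα, h1, h2⟩ := hA
  exact ⟨α, hα, (co_mulMat h).trans h1, h2.mulMat h⟩

/-- The span of the `e_A` with `A` outside the index set of `B^λ`, a left ideal. -/
def QSub (l : WComp n r) : Submodule (Schur n r) (Schur n r) :=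
  { Submodule.span ℂ (e '' (BSet l)ᶜ) with
    smul_mem' := fun x y hy => by
      change x * y ∈ Submodule.span ℂ (e '' (BSet l)ᶜ)
      induction hy using Submodule.span_induction with
      | zero => rw [mul_zero]; exact zero_mem _
      | add y y' _ _ hy hy' => rw [mul_add]; exact add_mem hy hy'
      | smul c y _ hy => rw [mul_smul_comm]; exact Submodule.smul_mem _ _ hy
      | mem y hy =>
        obtain ⟨A, hA, rfl⟩ := hy
        induction x using schur_induction with
        | zero => rw [zero_mul]; exact zero_mem _
        | add x x' hx hx' => rw [add_mul]; exact add_mem hx hx'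
        | smul c X =>
          rw [smul_mul_assoc]
          refine Submodule.smul_mem _ _ ?_
          by_cases h : co X.1 = ro A.1
          · rw [e_mul_e_of_eq h]
            exact Submodule.subset_span ⟨_, fun hC => hA (BSet.of_mul h hC), rfl⟩
          · rw [e_mul_e_of_ne h]; exact zero_mem _ }

/-- `P_λ`: the `ℂ`-vector space with basis `B^λ`, on which `b ∈ S_0(n,r)` acts by multiplication
followed by deleting the basis elements outside `B^λ`, that is, the quotient of the left regular
module by the span of the `e_A` with `A` outside the index set of `B^λ`. -/
abbrev P (l : WComp n r) : Type := Schur n r ⧸ QSub l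

/-- The class of `e_A` in `P_λ`: the basis element of `P_λ` if `A` is in the index set of `B^λ`,
and `0` otherwise. -/
def pBar (l : WComp n r) (A : Mat n r) : P l := Submodule.Quotient.mk (e A)

/-- `N_λ`: the `ℂ`-span of `B^λ \ β^λ` in `P_λ`, a submodule. -/
def N (l : WComp n r) : Submodule (Schur n r) (P l) :=
  { Submodule.span ℂ (pBar l '' (BSet l \ CB l)) with
    smul_mem' := fun x y hy => by
      change x • y ∈ Submodule.span ℂ (pBar l '' (BSet l \ CB l))
      induction hy using Submodule.span_induction with
      | zero => rw [smul_zero]; exact zero_mem _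
      | add y y' _ _ hy hy' => rw [smul_add]; exact add_mem hy hy'
      | smul c y _ hy => rw [smul_algebra_smul_comm]; exact Submodule.smul_mem _ _ hy
      | mem y hy =>
        obtain ⟨A, hA, rfl⟩ := hy
        induction x using schur_induction with
        | zero => rw [zero_smul]; exact zero_mem _
        | add x x' hx hx' => rw [add_smul]; exact add_mem hx hx'
        | smul c X =>
          rw [smul_assoc]
          refine Submodule.smul_mem _ _ ?_
          change (Submodule.Quotient.mk (e X * e A) : P l) ∈ _
          by_cases h : co X.1 = ro A.1
          · rw [e_mul_e_of_eq h]
            by_cases hB : X.mul A h ∈ BSet l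
            · exact Submodule.subset_span ⟨_, ⟨hB, fun hC => hA.2
                ⟨hC.1.of_mulMat h, (co_mulMat h).symm.trans hC.2⟩⟩, rfl⟩
            · have h0 : (Submodule.Quotient.mk (e (X.mul A h)) : P l) = 0 :=
                (Submodule.Quotient.mk_eq_zero _).2 (Submodule.subset_span ⟨_, hB, rfl⟩)
              rw [h0]; exact zero_mem _
          · rw [e_mul_e_of_ne h, Submodule.Quotient.mk_zero]; exact zero_mem _ }

/-- `S_λ = P_λ / N_λ`. -/
abbrev S (l : WComp n r) : Type := P l ⧸ N l

/-- The class `ē_A` of `e_A` in `S_λ`. -/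
def eBar (l : WComp n r) (A : Mat n r) : S l := Submodule.Quotient.mk (pBar l A)

/-- The class `k̄_λ` of `k_λ = e_{D_λ}` in `S_λ`. -/
def kBar (l : WComp n r) : S l := eBar l (diagMat l)

end

end ZeroSchur

namespace ZeroSchur

open Finset Schur

variable {n r : ℕ}

/-! ### Column block diagonal matrices -/

/-! The module `S l` has the classes of the `e A` with `A ∈ CB l` as a basis, and every generator
permutes these classes as far as it does not kill them. In a column block diagonal matrix, all
nonzero entries of a column lie strictly above those of any later column, so each row has at most
one nonzero entry. Hence the multiplication rules involve no choice: `eGen i` moves a unit up from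
row `i + 1` to row `i` within its column, `fGen i` moves one down, and the class of the result is
zero as soon as the result leaves `CB l`.

If a move ends in `CB l`, then the target row also has a single nonzero entry, so the opposite
generator returns the same unit. Thus `eGen i` and `fGen i` are mutually inverse partial injections
on the basis (`eGen_smul_eBar_eq_iff_fGen`), and reading words backwards gives (2) by induction
(`eGen_prod_smul_eBar_eq_iff`).

For (3), moving a unit across the cut between rows `k` and `k + 1` changes only the sum of the
entries above that cut, and changes it by one. The number of letters `k` in a word from `A` to the
diagonal matrix is therefore the difference of two such sums, which depends only on the two matrices
(`corner_eq_add_count`).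

For (1), one moves units up as long as the result stays in `CB l`. The process terminates because
the sums above the cuts are bounded by `r`, and under the condition on zeros of `l` the only matrix
in `CB l` without such a move is the diagonal one (`eq_diagMat_of_stuck`). -/

lemma IsColumnBlockDiagonal.lt {A : Matrix (Fin n) (Fin n) ℕ} (hA : IsColumnBlockDiagonal A)
    {i s j t : Fin n} (h : 0 < A i j) (h' : 0 < A s t) (hjt : j < t) : i < s :=
  not_le.1 fun hs => h'.ne' (hA i j h s t hs hjt)

lemma isColumnBlockDiagonal_iff {A : Matrix (Fin n) (Fin n) ℕ} : IsColumnBlockDiagonal A ↔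
    ∀ i s j t, 0 < A i j → 0 < A s t → j < t → i < s :=
  ⟨fun hA _ _ _ _ h h' hjt => hA.lt h h' hjt, fun H i j h s t hs hjt =>
    Nat.eq_zero_of_not_pos fun h' => not_le.2 (H i s j t h h' hjt) hs⟩

/-- Two nonzero entries of one row in different columns would have to lie in strictly increasing
rows. As a consequence, the first and the last nonzero entry of a row coincide, which makes the
`eGen` and `fGen` rules symmetric. -/
lemma IsColumnBlockDiagonal.col_unique {A : Matrix (Fin n) (Fin n) ℕ}
    (hA : IsColumnBlockDiagonal A) {i j t : Fin n} (h : 0 < A i j) (h' : 0 < A i t) : j = t := by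
  rcases lt_trichotomy j t with hjt | hjt | hjt
  · exact absurd (hA.lt h h' hjt) (lt_irrefl _)
  · exact hjt
  · exact absurd (hA.lt h' h hjt) (lt_irrefl _)

lemma IsColumnBlockDiagonal.eq_zero_of_ne {A : Matrix (Fin n) (Fin n) ℕ}
    (hA : IsColumnBlockDiagonal A) {i j t : Fin n} (h : 0 < A i j) (hjt : j ≠ t) : A i t = 0 :=
  Nat.eq_zero_of_not_pos fun h' => hjt (hA.col_unique h h')

lemma diagMat_mem_CB (l : WComp n r) : diagMat l ∈ CB l := by
  refine ⟨fun i j h s t hs hjt => ?_, co_diagonal l.1⟩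
  have hij : i = j := by
    by_contra hne
    exact absurd h (by simp [diagMat, hne])
  subst hij
  exact Matrix.diagonal_apply_ne _ (lt_of_le_of_lt hs hjt).ne

lemma exists_pos_of_mem_CB {l : WComp n r} {A : Mat n r} (hA : A ∈ CB l) {j : Fin n}
    (hj : l.1 j ≠ 0) : ∃ i, 0 < A.1 i j := by
  by_contra! h
  refine hj ?_
  rw [← hA.2]
  exact sum_eq_zero fun i _ => Nat.le_zero.1 (h i)

/-- A maximal composition other than `(1,…,1)` has a block of length at least two, and the columns
at both ends of this block are nonzero. Block diagonality puts an entry of the first strictly above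
an entry of the last, which openness on that block forbids. -/
lemma CB_subset_BSet {l : WComp n r} : CB l ⊆ BSet l := by
  intro A hA
  refine ⟨hA.2, fun hU => ?_⟩
  simp only [Set.mem_iUnion] at hU
  obtain ⟨α, ⟨hmax, hne⟩, -, hopen⟩ := hU
  obtain ⟨b, hb, hb1⟩ := Composition.ne_ones_iff.1 hne
  rw [← α.ofFn_blocksFun, List.mem_ofFn] at hb
  obtain ⟨v, rfl⟩ := hb
  rcases hmax v with h | ⟨hfst, hlst⟩
  -- A block of type `(0)` has length one, but the chosen block is longer.
  · omega
  · let s : Fin (α.blocksFun v) := ⟨0, by omega⟩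
    let t : Fin (α.blocksFun v) := ⟨α.blocksFun v - 1, by omega⟩
    obtain ⟨i, hi⟩ := exists_pos_of_mem_CB hA (hfst s rfl)
    obtain ⟨i', hi'⟩ := exists_pos_of_mem_CB hA (hlst t (by simp only [t]; omega))
    have hst : α.embedding v s < α.embedding v t :=
      (α.embedding v).lt_iff_lt.2 (Fin.lt_def.2 (by simp only [s, t]; omega))
    have hpart : ∀ (i : Fin n) (u : Fin (α.blocksFun v)),
        colPart A.1 α v i (α.embedding v u) = A.1 i (α.embedding v u) := by
      intro i u
      have h1 := α.sizeUpTo_succ' v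
      have h2 := u.2
      refine if_pos ⟨?_, ?_⟩ <;> rw [Composition.coe_embedding] <;> omega
    rcases hopen v i i' _ _ (hA.1.lt hi hi' hst) hst with h | h
    · rw [hpart] at h; omega
    · rw [hpart] at h; omega

/-! ### The classes of the standard basis elements in `S_λ` -/

lemma QSub_le_span {l : WComp n r} {x : Schur n r} (hx : x ∈ QSub l) :
    x ∈ Submodule.span ℂ (e '' (CB l)ᶜ) :=
  Submodule.span_mono (Set.image_mono (Set.compl_subset_compl.2 (CB_subset_BSet))) hx

lemma exists_mk_of_mem_N {l : WComp n r} {x : P l} (hx : x ∈ N l) :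
    ∃ y ∈ Submodule.span ℂ (e '' (CB l)ᶜ), (Submodule.Quotient.mk y : P l) = x := by
  change x ∈ Submodule.span ℂ (pBar l '' (BSet l \ CB l)) at hx
  induction hx using Submodule.span_induction with
  | zero => exact ⟨0, zero_mem _, rfl⟩
  | add x x' _ _ hx hx' =>
    obtain ⟨y, hy, rfl⟩ := hx
    obtain ⟨y', hy', rfl⟩ := hx'
    exact ⟨y + y', add_mem hy hy', rfl⟩
  | smul c x _ hx =>
    obtain ⟨y, hy, rfl⟩ := hx
    exact ⟨c • y, Submodule.smul_mem _ _ hy, rfl⟩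
  | mem x hx =>
    obtain ⟨A, hA, rfl⟩ := hx
    exact ⟨e A, Submodule.subset_span ⟨A, hA.2, rfl⟩, rfl⟩

/-- The two successive quotients collapse into one: both `QSub l` and lifts of elements of `N l` lie
in the span of the `e A` with `A` outside `CB l`. Statements about `S l` thereby reduce to
coordinates in the standard basis. -/
lemma mem_span_of_mk_mk_eq_zero {l : WComp n r} {x : Schur n r}
    (h : (Submodule.Quotient.mk (Submodule.Quotient.mk x : P l) : S l) = 0) :
    x ∈ Submodule.span ℂ (e '' (CB l)ᶜ) := by
  obtain ⟨y, hy, hxy⟩ := exists_mk_of_mem_N ((Submodule.Quotient.mk_eq_zero _).1 h)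
  have := add_mem (QSub_le_span ((Submodule.Quotient.eq _).1 hxy.symm)) hy
  rwa [sub_add_cancel] at this

open Classical in
lemma repr_eq_zero_of_mem_span {l : WComp n r} {A : Mat n r} (hA : A ∈ CB l) {x : Schur n r}
    (hx : x ∈ Submodule.span ℂ (e '' (CB l)ᶜ)) : (basis n r).repr x A = 0 := by
  induction hx using Submodule.span_induction with
  | zero => rw [map_zero, Finsupp.zero_apply]
  | add x y _ _ hx hy => rw [map_add, Finsupp.add_apply, hx, hy, add_zero]
  | smul c x _ hx => rw [map_smul, Finsupp.smul_apply, hx, smul_zero]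
  | mem x hx =>
    obtain ⟨B, hB, rfl⟩ := hx
    rw [← basis_apply, Module.Basis.repr_self, Finsupp.single_apply, if_neg]
    rintro rfl
    exact hB hA

lemma eBar_ne_zero {l : WComp n r} {A : Mat n r} (hA : A ∈ CB l) :
    eBar l A ≠ 0 := by
  intro h
  have := repr_eq_zero_of_mem_span hA (mem_span_of_mk_mk_eq_zero h)
  rw [← basis_apply, Module.Basis.repr_self, Finsupp.single_eq_same] at this
  exact one_ne_zero this

open Classical in
-- The coordinate at `A` vanishes on everything that is killed in `S l`, and it separates `e A` from
-- any other basis element. Membership in `CB l` is needed for one of the two matrices only.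
lemma eBar_injOn {l : WComp n r} {A B : Mat n r} (hA : A ∈ CB l)
    (h : eBar l A = eBar l B) : A = B := by
  have h0 : (Submodule.Quotient.mk (Submodule.Quotient.mk (e A - e B) : P l) : S l) = 0 :=
    sub_eq_zero.2 h
  have := repr_eq_zero_of_mem_span hA (mem_span_of_mk_mk_eq_zero h0)
  rw [map_sub, Finsupp.sub_apply, ← basis_apply, ← basis_apply, Module.Basis.repr_self,
    Module.Basis.repr_self, Finsupp.single_eq_same, Finsupp.single_apply, sub_eq_zero] at this
  by_contra hne
  rw [if_neg fun h => hne h.symm] at this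
  exact one_ne_zero this

lemma eBar_eq_zero {l : WComp n r} {A : Mat n r} (hA : A ∉ CB l) : eBar l A = 0 := by
  by_cases hB : A ∈ BSet l
  · exact (Submodule.Quotient.mk_eq_zero _).2 (Submodule.subset_span ⟨A, ⟨hB, hA⟩, rfl⟩)
  · have h0 : pBar l A = 0 :=
      (Submodule.Quotient.mk_eq_zero _).2 (Submodule.subset_span ⟨A, hB, rfl⟩)
    rw [eBar, h0, Submodule.Quotient.mk_zero]

lemma smul_eBar_of_mul_eq {l : WComp n r} {x : Schur n r} {A B : Mat n r}
    (h : x * e A = e B) : x • eBar l A = eBar l B :=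
  congrArg (fun y => (Submodule.Quotient.mk (Submodule.Quotient.mk y : P l) : S l)) h

lemma smul_eBar_of_mul_eq_zero {l : WComp n r} {x : Schur n r} {A : Mat n r}
    (h : x * e A = 0) : x • eBar l A = 0 :=
  congrArg (fun y => (Submodule.Quotient.mk (Submodule.Quotient.mk y : P l) : S l)) h

/-! ### Moving a unit to an adjacent row -/

lemma move_apply (A : Mat n r) (s t c : Fin n) (h : 0 < A.1 s c) (a b : Fin n) :
    (move A s t c h).1 a b = A.1 a b - (if a = s ∧ b = c then 1 else 0)
      + (if a = t ∧ b = c then 1 else 0) := by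
  have hs : ∀ s : Fin n, (Matrix.single s c 1 : Matrix (Fin n) (Fin n) ℕ) a b =
      if a = s ∧ b = c then 1 else 0 := fun s => by
    rw [Matrix.single_apply]; simp only [eq_comm]
  rw [← hs, ← hs]
  rfl

lemma co_move (A : Mat n r) (s t c : Fin n) (h : 0 < A.1 s c) :
    co (move A s t c h).1 = co A.1 :=
  co_eq_of_corner _ _ fun j => by rw [corner_move, if_pos s.2, if_pos t.2, sub_add_cancel]

lemma move_apply_target_pos (A : Mat n r) (s t c : Fin n) (h : 0 < A.1 s c) :
    0 < (move A s t c h).1 t c := by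
  simp [move_apply]

lemma move_move (A : Mat n r) {s t : Fin n} (hst : s ≠ t) (c : Fin n) (h : 0 < A.1 s c) :
    move (move A s t c h) t s c (move_apply_target_pos A s t c h) = A := by
  refine Subtype.ext (Matrix.ext fun a b => ?_)
  rw [move_apply, move_apply]
  by_cases h1 : a = s ∧ b = c
  · obtain ⟨rfl, rfl⟩ := h1
    simp [hst]; omega
  · simp [h1]

/-- Rows `s` and `t` are adjacent, so a moved unit can break the strict order between columns only
by landing in a row that another column already occupies; `ht` excludes this. -/
lemma move_mem_CB {l : WComp n r} {A : Mat n r} (hA : A ∈ CB l) {s t c : Fin n}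
    (hst : (s : ℕ) = t + 1 ∨ (t : ℕ) = s + 1) (h : 0 < A.1 s c)
    (ht : ∀ j, j ≠ c → A.1 t j = 0) : move A s t c h ∈ CB l := by
  have hpos : ∀ a b, 0 < (move A s t c h).1 a b → 0 < A.1 a b ∨ (a = t ∧ b = c) := by
    intro a b hab
    rw [move_apply] at hab
    split_ifs at hab <;> first | (right; assumption) | (left; omega)
  have hne : ∀ a b, 0 < A.1 a b → b ≠ c → (a : ℕ) ≠ t := by
    intro a b hab hb e
    obtain rfl := Fin.ext e
    exact hab.ne' (ht b hb)
  refine ⟨isColumnBlockDiagonal_iff.2 fun i i' j j' hi hi' hj => ?_, (co_move A s t c h).trans hA.2⟩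
  rcases hpos i j hi with h1 | ⟨rfl, rfl⟩
  · rcases hpos i' j' hi' with h2 | ⟨rfl, rfl⟩
    · exact hA.1.lt h1 h2 hj
    · have h3 := hA.1.lt h1 h hj
      have h4 := hne i j h1 hj.ne
      rw [Fin.lt_def] at h3 ⊢
      omega
  · rcases hpos i' j' hi' with h2 | ⟨rfl, rfl⟩
    · have h3 := hA.1.lt h h2 hj
      have h4 := hne i' j' h2 hj.ne'
      rw [Fin.lt_def] at h3 ⊢
      omega
    · exact absurd hj (lt_irrefl _)

lemma row₂_ne_row₁ (i : Fin (n - 1)) : row₂ i ≠ row₁ i :=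
  fun h => by simpa [row₁, row₂] using congrArg Fin.val h

/-- Any nonzero entry of the row is its last one, so the maximality condition of the multiplication
rule is automatic. The right-hand side may be zero, when the moved matrix is not in `CB l`. -/
lemma eGen_smul_eBar_of_pos {l : WComp n r} {A : Mat n r} (hA : A ∈ CB l) {i : Fin (n - 1)}
    {p : Fin n} (hp : 0 < A.1 (row₂ i) p) :
    (eGen i : Schur n r) • eBar l A = eBar l (move A (row₂ i) (row₁ i) p hp) :=
  smul_eBar_of_mul_eq (eGen_mul_e_move i A p hp fun _ hj => hA.1.eq_zero_of_ne hp hj.ne)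

lemma fGen_smul_eBar_of_pos {l : WComp n r} {A : Mat n r} (hA : A ∈ CB l) {i : Fin (n - 1)}
    {p : Fin n} (hp : 0 < A.1 (row₁ i) p) :
    (fGen i : Schur n r) • eBar l A = eBar l (move A (row₁ i) (row₂ i) p hp) :=
  smul_eBar_of_mul_eq (fGen_mul_e_move i A p hp fun _ hj => hA.1.eq_zero_of_ne hp hj.ne')

lemma exists_pos_of_ro_ne_zero {A : Matrix (Fin n) (Fin n) ℕ} {s : Fin n} (h : ro A s ≠ 0) :
    ∃ p, 0 < A s p := by
  by_contra! h'
  exact h (sum_eq_zero fun j _ => Nat.le_zero.1 (h' j))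

lemma eGen_smul_eBar_cases {l : WComp n r} {A : Mat n r} (hA : A ∈ CB l) (i : Fin (n - 1)) :
    (eGen i : Schur n r) • eBar l A = 0 ∨ ∃ p, ∃ hp : 0 < A.1 (row₂ i) p,
      move A (row₂ i) (row₁ i) p hp ∈ CB l ∧
      (eGen i : Schur n r) • eBar l A = eBar l (move A (row₂ i) (row₁ i) p hp) := by
  by_cases h0 : ro A.1 (row₂ i) = 0
  · exact Or.inl (smul_eBar_of_mul_eq_zero (eGen_mul_e_zero i A h0))
  · obtain ⟨p, hp⟩ := exists_pos_of_ro_ne_zero h0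
    have h := eGen_smul_eBar_of_pos hA hp
    by_cases hB : move A (row₂ i) (row₁ i) p hp ∈ CB l
    · exact Or.inr ⟨p, hp, hB, h⟩
    · exact Or.inl (h.trans (eBar_eq_zero hB))

lemma fGen_smul_eBar_cases {l : WComp n r} {A : Mat n r} (hA : A ∈ CB l) (i : Fin (n - 1)) :
    (fGen i : Schur n r) • eBar l A = 0 ∨ ∃ p, ∃ hp : 0 < A.1 (row₁ i) p,
      move A (row₁ i) (row₂ i) p hp ∈ CB l ∧
      (fGen i : Schur n r) • eBar l A = eBar l (move A (row₁ i) (row₂ i) p hp) := by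
  by_cases h0 : ro A.1 (row₁ i) = 0
  · exact Or.inl (smul_eBar_of_mul_eq_zero (fGen_mul_e_zero i A h0))
  · obtain ⟨p, hp⟩ := exists_pos_of_ro_ne_zero h0
    have h := fGen_smul_eBar_of_pos hA hp
    by_cases hB : move A (row₁ i) (row₂ i) p hp ∈ CB l
    · exact Or.inr ⟨p, hp, hB, h⟩
    · exact Or.inl (h.trans (eBar_eq_zero hB))

/-- Since the class of `B` is nonzero and determines `B`, an equation in the module becomes an
equation between matrices. -/
lemma eGen_smul_eBar_eq_iff {l : WComp n r} {A B : Mat n r} (hA : A ∈ CB l)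
    (hB : B ∈ CB l) (i : Fin (n - 1)) : (eGen i : Schur n r) • eBar l A = eBar l B ↔
      ∃ p, ∃ hp : 0 < A.1 (row₂ i) p, B = move A (row₂ i) (row₁ i) p hp := by
  constructor
  · intro h
    rcases eGen_smul_eBar_cases hA i with h0 | ⟨p, hp, -, h'⟩
    · exact absurd (h.symm.trans h0) (eBar_ne_zero hB)
    · exact ⟨p, hp, eBar_injOn hB (h.symm.trans h')⟩
  · rintro ⟨p, hp, rfl⟩
    exact eGen_smul_eBar_of_pos hA hp

lemma fGen_smul_eBar_eq_iff {l : WComp n r} {A B : Mat n r} (hA : A ∈ CB l)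
    (hB : B ∈ CB l) (i : Fin (n - 1)) : (fGen i : Schur n r) • eBar l A = eBar l B ↔
      ∃ p, ∃ hp : 0 < A.1 (row₁ i) p, B = move A (row₁ i) (row₂ i) p hp := by
  constructor
  · intro h
    rcases fGen_smul_eBar_cases hA i with h0 | ⟨p, hp, -, h'⟩
    · exact absurd (h.symm.trans h0) (eBar_ne_zero hB)
    · exact ⟨p, hp, eBar_injOn hB (h.symm.trans h')⟩
  · rintro ⟨p, hp, rfl⟩
    exact fGen_smul_eBar_of_pos hA hp

/-- On the basis of `S_λ`, the generators `e_i` and `f_i` act as mutually inverse partial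
injections. -/
lemma eGen_smul_eBar_eq_iff_fGen {l : WComp n r} {A B : Mat n r}
    (hA : A ∈ CB l) (hB : B ∈ CB l) (i : Fin (n - 1)) :
    (eGen i : Schur n r) • eBar l A = eBar l B ↔ (fGen i : Schur n r) • eBar l B = eBar l A := by
  rw [eGen_smul_eBar_eq_iff hA hB, fGen_smul_eBar_eq_iff hB hA]
  constructor
  · rintro ⟨p, hp, rfl⟩
    exact ⟨p, move_apply_target_pos _ _ _ _ _, (move_move A (row₂_ne_row₁ i) p hp).symm⟩
  · rintro ⟨p, hp, rfl⟩
    exact ⟨p, move_apply_target_pos _ _ _ _ _, (move_move B (row₂_ne_row₁ i).symm p hp).symm⟩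

/-! ### Words in the generators -/

lemma eGen_prod_smul_eBar_cases {l : WComp n r} {A : Mat n r} (hA : A ∈ CB l)
    (w : List (Fin (n - 1))) :
    ((w.map eGen).prod : Schur n r) • eBar l A = 0 ∨
      ∃ B ∈ CB l, ((w.map eGen).prod : Schur n r) • eBar l A = eBar l B := by
  induction w with
  | nil => exact Or.inr ⟨A, hA, by simp⟩
  | cons i w ih =>
    simp only [List.map_cons, List.prod_cons, mul_smul]
    rcases ih with h | ⟨B, hB, h⟩
    · left; rw [h, smul_zero]
    · rw [h]
      rcases eGen_smul_eBar_cases hB i with h' | ⟨p, hp, hC, h'⟩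
      · exact Or.inl h'
      · exact Or.inr ⟨_, hC, h'⟩

/-- A word that ends at a nonzero class never passes through zero, so every intermediate value is
the class of a matrix in `CB l`. -/
lemma eGen_prod_cons_smul_eBar_eq_iff {l : WComp n r} {A C : Mat n r}
    (hA : A ∈ CB l) (hC : C ∈ CB l) (i : Fin (n - 1)) (w : List (Fin (n - 1))) :
    (((i :: w).map eGen).prod : Schur n r) • eBar l A = eBar l C ↔
      ∃ B ∈ CB l, ((w.map eGen).prod : Schur n r) • eBar l A = eBar l B ∧
        (eGen i : Schur n r) • eBar l B = eBar l C := by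
  simp only [List.map_cons, List.prod_cons, mul_smul]
  constructor
  · intro h
    rcases eGen_prod_smul_eBar_cases hA w with h0 | ⟨B, hB, h'⟩
    · rw [h0, smul_zero] at h
      exact absurd h.symm (eBar_ne_zero hC)
    · exact ⟨B, hB, h', by rw [← h', h]⟩
  · rintro ⟨B, -, h, h'⟩
    rw [h, h']

/-- This inverts a composite of partial injections letter by letter. The letter `i` at the head acts
last among the `eGen`, and first among the `fGen` of the reversed word, so the induction shortens
the path at its end `C`. -/
lemma eGen_prod_smul_eBar_eq_iff {l : WComp n r} {A C : Mat n r}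
    (hA : A ∈ CB l) (hC : C ∈ CB l) (w : List (Fin (n - 1))) :
    ((w.map eGen).prod : Schur n r) • eBar l A = eBar l C ↔
      ((w.reverse.map fGen).prod : Schur n r) • eBar l C = eBar l A := by
  induction w generalizing C with
  | nil => simp [eq_comm]
  | cons i w ih =>
    rw [eGen_prod_cons_smul_eBar_eq_iff hA hC]
    simp only [List.reverse_cons, List.map_append, List.map_cons, List.map_nil, List.prod_append,
      List.prod_singleton, mul_smul]
    constructor
    · rintro ⟨B, hB, h, h'⟩
      rw [(eGen_smul_eBar_eq_iff_fGen hB hC i).1 h', (ih hB).1 h]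
    · intro h
      rcases fGen_smul_eBar_cases hC i with h0 | ⟨p, hp, hB, h'⟩
      · rw [h0, smul_zero] at h
        exact absurd h.symm (eBar_ne_zero hA)
      · rw [h'] at h
        exact ⟨_, hB, (ih hB).2 h, (eGen_smul_eBar_eq_iff_fGen hB hC i).2 h'⟩

/-- The number of occurrences of `e_k` in a word is read off from the row sums. -/
lemma corner_eq_add_count {l : WComp n r} {A C : Mat n r}
    (hA : A ∈ CB l) (hC : C ∈ CB l) {w : List (Fin (n - 1))}
    (h : ((w.map eGen).prod : Schur n r) • eBar l A = eBar l C) (k : Fin (n - 1)) :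
    corner C.1 (k + 1) n = corner A.1 (k + 1) n + w.count k := by
  induction w generalizing C with
  | nil =>
    have : A = C := eBar_injOn hA (by simpa using h)
    simp [this]
  | cons i w ih =>
    obtain ⟨B, hB, h1, h2⟩ := (eGen_prod_cons_smul_eBar_eq_iff hA hC i w).1 h
    obtain ⟨p, hp, rfl⟩ := (eGen_smul_eBar_eq_iff hB hC i).1 h2
    -- A unit moving from row `i + 1` to row `i` enters the first `k + 1` rows precisely when `k =
    -- i`.
    rw [corner_move, ih hB h1, if_pos p.2, List.count_cons]
    simp only [row₁, row₂, beq_iff_eq, Fin.ext_iff]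
    split_ifs <;> push_cast <;> omega

/-! ### Reaching the diagonal matrix -/

/-- A column block diagonal matrix without admissible upward moves is diagonal. -/
lemma eq_diagMat_of_stuck {l : WComp n r} (hl : IsBullet l) {A : Mat n r} (hA : A ∈ CB l)
    (hs : ∀ (i : Fin (n - 1)) (p : Fin n), 0 < A.1 (row₂ i) p →
      ∃ j, j ≠ p ∧ 0 < A.1 (row₁ i) j) : A = diagMat l := by
  -- Strong induction over the rows from the top: every nonzero entry lies on the diagonal.
  have key : ∀ (m : ℕ) (i j : Fin n), (i : ℕ) = m → 0 < A.1 i j → i = j := by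
    intro m
    induction m using Nat.strong_induction_on with
    | _ m ih =>
      intro i j him hij
      have hle : i ≤ j := by
        rcases Nat.eq_zero_or_pos (i : ℕ) with h0 | h0
        · exact Fin.le_def.2 (by omega)
        · let i' : Fin (n - 1) := ⟨i - 1, by omega⟩
          have h2 : row₂ i' = i := Fin.ext (by simp only [row₂, i']; omega)
          have h1 : ((row₁ i' : Fin n) : ℕ) = i - 1 := rfl
          -- The upward move is blocked by an entry of row `i - 1` in another column `j'`, and `j' =
          -- i - 1` by induction. Block diagonality excludes `j < j'`, so `i - 1 < j`.
          obtain ⟨j', hne, hj'⟩ := hs i' j (by rwa [h2])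
          have h3 := ih _ (by omega) _ _ rfl hj'
          rcases lt_or_gt_of_ne hne with h4 | h4
          · rw [Fin.le_def]; rw [← h3, Fin.lt_def] at h4; omega
          · have h5 := hA.1.lt hij hj' h4
            rw [Fin.lt_def] at h5; omega
      rcases hle.lt_or_eq with hlt | heq
      -- If `i < j`, the condition on zeros of `l` makes column `i` nonzero as well. Its entry in
      -- row `s` must lie strictly above row `i`, but by induction an entry of such a row is
      -- diagonal, so `s = i`.
      · have hjl : l.1 j ≠ 0 := by
          rw [← hA.2]
          exact (lt_of_lt_of_le hij (single_le_sum (f := fun i => A.1 i j)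
            (fun _ _ => Nat.zero_le _) (mem_univ i))).ne'
        obtain ⟨s, hs'⟩ := exists_pos_of_mem_CB hA fun h => hjl (hl i j hlt h)
        have h1 := hA.1.lt hs' hij hlt
        have h2 := ih s (by rw [Fin.lt_def] at h1; omega) s i rfl hs'
        exact absurd h2 h1.ne
      · exact heq
  refine Subtype.ext (Matrix.ext fun i j => ?_)
  have hoff : ∀ i j, i ≠ j → A.1 i j = 0 := fun i j hne =>
    Nat.eq_zero_of_not_pos fun h => hne (key _ i j rfl h)
  change A.1 i j = Matrix.diagonal l.1 i j
  rw [Matrix.diagonal_apply]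
  split_ifs with hij
  · subst hij
    rw [← hA.2]
    exact (sum_eq_single i (fun s _ hs => hoff s i hs) fun h => absurd (mem_univ _) h).symm
  · exact hoff i j hij

lemma corner_n_n (A : Mat n r) : corner A.1 n n = r := by
  rw [corner_row A.1 n le_rfl, Finset.sum_range]
  simp only [Fin.is_lt, dite_true, Fin.eta]
  rw [← Nat.cast_sum]
  exact congrArg Nat.cast A.2

/-- Descent on the sum over all row cuts of the number of units below the cut. This is nonnegative
and drops by one with each upward move, and a move within `CB l` exists unless the matrix is
diagonal. -/
lemma exists_eGen_prod_smul_eBar {l : WComp n r} (hl : IsBullet l) {A : Mat n r}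
    (hA : A ∈ CB l) :
    ∃ w : List (Fin (n - 1)), ((w.map eGen).prod : Schur n r) • eBar l A = kBar l := by
  -- The bound is strict, so the case `m = 0` is contradictory.
  obtain ⟨m, hm⟩ : ∃ m : ℕ, ∑ k ∈ range n, ((r : ℤ) - corner A.1 (k + 1) n) < m :=
    ⟨_, Int.lt_add_one_iff.2 (Int.self_le_toNat _)⟩
  induction m generalizing A with
  | zero =>
    refine absurd hm (not_lt.2 (sum_nonneg fun k _ => sub_nonneg.2 ?_))
    exact (corner_le_n_left A.1 _ n).trans (corner_n_n A).le
  | succ m ih =>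
    by_cases hD : A = diagMat l
    · exact ⟨[], by simp [hD, kBar]⟩
    · obtain ⟨i, p, hp, hi⟩ : ∃ (i : Fin (n - 1)) (p : Fin n), 0 < A.1 (row₂ i) p ∧
          ∀ j, j ≠ p → A.1 (row₁ i) j = 0 := by
        by_contra! h
        exact hD (eq_diagMat_of_stuck hl hA fun i p hp =>
          (h i p hp).imp fun j hj => ⟨hj.1, Nat.pos_of_ne_zero hj.2⟩)
      have hB := move_mem_CB hA (Or.inl rfl) hp hi
      obtain ⟨w, hw⟩ := ih hB (by
        have hc : ∀ k, (r : ℤ) - corner (move A (row₂ i) (row₁ i) p hp).1 (k + 1) n =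
            r - corner A.1 (k + 1) n - if k = i then 1 else 0 := by
          intro k
          rw [corner_move, if_pos p.2]
          simp only [row₁, row₂]
          split_ifs <;> omega
        simp only [hc, sum_sub_distrib (f := fun k => (r : ℤ) - corner A.1 (k + 1) n),
          sum_ite_eq', mem_range]
        rw [if_pos (by omega)]
        push_cast at hm
        linarith)
      -- The move `i` is made first, so its generator stands at the right end of the product.
      refine ⟨w ++ [i], ?_⟩
      rw [List.map_append, List.prod_append, mul_smul, List.map_singleton, List.prod_singleton,
        eGen_smul_eBar_of_pos hA hp, hw]

end ZeroSchur

theorem mainTheorem12 (n r : ℕ) (l : ZeroSchur.WComp n r) (hl : ZeroSchur.IsBullet l)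
    (A : ZeroSchur.Mat n r) (hA : A ∈ ZeroSchur.CB l) :
    (∃ w : List (Fin (n - 1)),
      ((w.map ZeroSchur.Schur.eGen).prod : ZeroSchur.Schur n r) • ZeroSchur.eBar l A =
        ZeroSchur.kBar l) ∧
    (∀ w : List (Fin (n - 1)),
      ((w.map ZeroSchur.Schur.eGen).prod : ZeroSchur.Schur n r) • ZeroSchur.eBar l A =
          ZeroSchur.kBar l ↔
        ZeroSchur.eBar l A =
          ((w.reverse.map ZeroSchur.Schur.fGen).prod : ZeroSchur.Schur n r) •
            ZeroSchur.kBar l) ∧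
    (∀ w w' : List (Fin (n - 1)),
      ZeroSchur.eBar l A =
        ((w.reverse.map ZeroSchur.Schur.fGen).prod : ZeroSchur.Schur n r) • ZeroSchur.kBar l →
      ZeroSchur.eBar l A =
        ((w'.reverse.map ZeroSchur.Schur.fGen).prod : ZeroSchur.Schur n r) • ZeroSchur.kBar l →
      (w : Multiset (Fin (n - 1))) = (w' : Multiset (Fin (n - 1))) ∧ w.length = w'.length) := by
  have hk := ZeroSchur.diagMat_mem_CB l
  have h2 := fun w => ZeroSchur.eGen_prod_smul_eBar_eq_iff hA hk w
  refine ⟨ZeroSchur.exists_eGen_prod_smul_eBar hl hA, fun w => (h2 w).trans eq_comm,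
    fun w w' hw hw' => ?_⟩
  have hcount : (w : Multiset (Fin (n - 1))) = (w' : Multiset (Fin (n - 1))) := by
    refine Multiset.coe_eq_coe.2 (List.perm_iff_count.2 fun k => ?_)
    -- By (2), both words of `fGen` turn into words of `eGen` from `A` to the diagonal matrix, and
    -- the row sums of these two matrices fix the multiplicity of `k`.
    have h := ZeroSchur.corner_eq_add_count hA hk ((h2 w).2 hw.symm) k
    have h' := ZeroSchur.corner_eq_add_count hA hk ((h2 w').2 hw'.symm) k
    omega
  exact ⟨hcount, congrArg Multiset.card hcount⟩
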